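/- Let $\Delta$ be a (finite, crystallographic, reduced) root system of type $D_n$, $n\ge 3$ (the root system of $\mathfrak g=\mathfrak{so}_{2n}$; $D_3=A_3$), with a base $\Pi$ of simple roots and the corresponding set $\Delta^+$ of positive roots, partially ordered by the standard root order, in which $\gamma$ covers $\mu$ if and only if $\gamma-\mu\in\Pi$. Let $\mathfrak{Ab}$ be the poset, under inclusion, of all abelian ideals, i.e. of all subsets $I\subset\Delta^+$ that are upwards closed in the root order and satisfy $\gamma'+\gamma''\notin\Delta^+$ for all $\gamma',\gamma''\in I$. (These correspond to the abelian ideals of a Borel subalgebra of $\mathfrak g$.) For a finite poset $\mathcal P$ and $x\in\mathcal P$ let $\kappa(x)$ be the number of elements covered by $x$ and $\iota(x)$ the number of elements that cover $x$. The upper and the lower covering polynomial of $\mathcal P$ are $$\overline{\mathcal K}_{\mathcal P}(q)=\sum_{x\in\mathcal P}q^{\kappa(x)},\qquad \underline{\mathcal K}_{\mathcal P}(q)=\sum_{x\in\mathcal P}q^{\iota(x)},$$ and the deviation polynomial $\mathcal D_{\mathcal P}$ is the polynomial with $\overline{\mathcal K}_{\mathcal P}(q)-\underline{\mathcal K}_{\mathcal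 P}(q)=(q-1)^2\,\mathcal D_{\mathcal P}(q)$. Then, with the convention $\binom{a}{m}=0$ for $m<0$, (i) $\displaystyle \overline{\mathcal K}_{\mathfrak{Ab}}(q)=\sum_{k\ge 0}\Bigl(\binom{n+2}{2k}-4\binom{n-1}{2k-2}\Bigr)q^k=\sum_{k\ge 0}\Bigl(\binom{n}{2k}+\binom{n-1}{2k-1}+\binom{n-2}{2k-1}+\binom{n-2}{2k-4}\Bigr)q^k$; (ii) $\displaystyle \underline{\mathcal K}_{\mathfrak{Ab}}(q)=\sum_{k\ge 0}\Bigl(\binom{n}{2k+1}+\binom{n}{2k-2}\Bigr)q^k$; (iii) $\displaystyle \mathcal D_{\mathfrak{Ab}}(q)=-\sum_{k\ge 0}\Bigl(\binom{n-2}{2k+1}+\binom{n-3}{2k}\Bigr)q^k$. -/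

import Mathlib

open Polynomial

noncomputable section

/-! ### Covering polynomials of a finite poset -/

section Poset

variable {α : Type*} [PartialOrder α]

/-- `κ(x)`: the number of elements covered by `x`. -/
def numCoveredBy (x : α) : ℕ := Nat.card {y : α // y ⋖ x}

/-- `ι(x)`: the number of elements that cover `x`. -/
def numCovering (x : α) : ℕ := Nat.card {y : α // x ⋖ y}

theorem sum_numCoveredBy_eq (α : Type*) [PartialOrder α] [Fintype α] :
    ∑ x : α, numCoveredBy x = ∑ x : α, numCovering x := by
  classical
  simp only [numCoveredBy, numCovering, Nat.card_eq_fintype_card, Fintype.card_subtype,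
    Finset.card_filter]
  exact Finset.sum_comm

theorem X_sub_one_sq_dvd_pow_sub (k : ℕ) :
    ((X - 1) ^ 2 : ℤ[X]) ∣ X ^ k - 1 - (k : ℤ[X]) * (X - 1) := by
  induction k with
  | zero => simp
  | succ k ih =>
    obtain ⟨p, hp⟩ := ih
    refine ⟨X * p + (k : ℤ[X]), ?_⟩
    push_cast
    linear_combination (X : ℤ[X]) * hp

variable (α) [Finite α]

/-- The upper covering polynomial `∑ x, q ^ κ(x)` of a finite poset. -/
def upperCoveringPoly : ℤ[X] := ∑ᶠ x : α, X ^ numCoveredBy x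

/-- The lower covering polynomial `∑ x, q ^ ι(x)` of a finite poset. -/
def lowerCoveringPoly : ℤ[X] := ∑ᶠ x : α, X ^ numCovering x

/-- The deviation polynomial of a finite poset: the quotient of the difference of the upper and
the lower covering polynomial by `(q - 1) ^ 2`. The division is exact, see
`upperCoveringPoly_sub_lowerCoveringPoly`. -/
def deviationPoly : ℤ[X] :=
  (upperCoveringPoly α - lowerCoveringPoly α) /ₘ (X - 1) ^ 2

theorem X_sub_one_sq_dvd_sub :
    ((X - 1) ^ 2 : ℤ[X]) ∣ upperCoveringPoly α - lowerCoveringPoly α := by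
  classical
  have := Fintype.ofFinite α
  have key (f : α → ℕ) : ((X - 1) ^ 2 : ℤ[X]) ∣
      ∑ x, X ^ f x - (Fintype.card α : ℤ[X]) - ((∑ x, f x : ℕ) : ℤ[X]) * (X - 1) := by
    have h : ∑ x, X ^ f x - (Fintype.card α : ℤ[X]) - ((∑ x, f x : ℕ) : ℤ[X]) * (X - 1)
        = ∑ x, (X ^ f x - 1 - (f x : ℤ[X]) * (X - 1)) := by
      simp [Finset.sum_sub_distrib, Finset.sum_mul]
    rw [h]
    exact Finset.dvd_sum fun x _ => X_sub_one_sq_dvd_pow_sub (f x)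
  have h := dvd_sub (key numCoveredBy) (key numCovering)
  rw [sum_numCoveredBy_eq α] at h
  rw [upperCoveringPoly, lowerCoveringPoly, finsum_eq_sum_of_fintype, finsum_eq_sum_of_fintype]
  convert h using 1
  ring

/-- The defining property of the deviation polynomial. -/
theorem upperCoveringPoly_sub_lowerCoveringPoly :
    upperCoveringPoly α - lowerCoveringPoly α = (X - 1) ^ 2 * deviationPoly α := by
  have hm : ((X - 1) ^ 2 : ℤ[X]).Monic := by
    simpa using (monic_X_sub_C (1 : ℤ)).pow 2
  have h := modByMonic_add_div (upperCoveringPoly α - lowerCoveringPoly α) ((X - 1) ^ 2)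
  rw [(modByMonic_eq_zero_iff_dvd hm).mpr (X_sub_one_sq_dvd_sub α), zero_add] at h
  exact h.symm

end Poset

/-! ### The poset of positive roots and the poset of abelian ideals -/

section Roots

variable {ι R M N : Type*} [CommRing R] [CharZero R] [AddCommGroup M] [Module R M]
  [AddCommGroup N] [Module R N] {P : RootPairing ι R M N}

/-- The set `Δ⁺` of positive roots with respect to the base `b`. -/
def PosRoot (b : P.Base) : Type _ := {i : ι // b.IsPos i}

/-- The positive root, as a vector. -/
def PosRoot.vec {b : P.Base} (γ : PosRoot b) : M := P.root γ.1

/-- `γ - μ` is a simple root. -/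
def PosRoot.Step {b : P.Base} (μ γ : PosRoot b) : Prop :=
  ∃ i ∈ b.support, γ.vec - μ.vec = P.root i

theorem PosRoot.Step.height_lt {b : P.Base} {μ γ : PosRoot b} (h : PosRoot.Step μ γ) :
    b.height μ.1 < b.height γ.1 := by
  obtain ⟨i, hi, h⟩ := h
  have h1 := b.height_add (i := μ.1) (j := i) (k := γ.1)
    (by rw [← h]; simp [PosRoot.vec])
  have h2 := b.height_one_of_mem_support hi
  omega

theorem PosRoot.height_le_of_reflTransGen {b : P.Base} {μ γ : PosRoot b}
    (h : Relation.ReflTransGen PosRoot.Step μ γ) : b.height μ.1 ≤ b.height γ.1 := by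
  induction h with
  | refl => exact le_rfl
  | tail _ h ih => exact ih.trans h.height_lt.le

/-- The standard root order on `Δ⁺`: the order generated by the relations `μ ≼ γ` for
`γ - μ` simple. -/
instance (b : P.Base) : PartialOrder (PosRoot b) where
  le := Relation.ReflTransGen PosRoot.Step
  le_refl _ := Relation.ReflTransGen.refl
  le_trans _ _ _ := Relation.ReflTransGen.trans
  le_antisymm μ γ h h' := by
    rcases Relation.ReflTransGen.cases_head h with h | ⟨ν, h1, h2⟩
    · exact h
    · have a := h1.height_lt
      have b := PosRoot.height_le_of_reflTransGen h2
      have c := PosRoot.height_le_of_reflTransGen h'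
      omega

instance (b : P.Base) [Finite ι] : Finite (PosRoot b) :=
  inferInstanceAs (Finite {i : ι // b.IsPos i})

/-- An upper ideal (dual order ideal) `I` of `Δ⁺` is abelian if the sum of two elements of `I`
is never a positive root. -/
def IsAbelianIdeal {b : P.Base} (I : Set (PosRoot b)) : Prop :=
  IsUpperSet I ∧ ∀ γ ∈ I, ∀ γ' ∈ I, ¬ ∃ δ : PosRoot b, δ.vec = γ.vec + γ'.vec

/-- The poset `Ab` of abelian ideals, ordered by inclusion. -/
def AbelianIdeals (b : P.Base) : Type _ := {I : Set (PosRoot b) // IsAbelianIdeal I}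

instance (b : P.Base) : PartialOrder (AbelianIdeals b) :=
  inferInstanceAs (PartialOrder {I : Set (PosRoot b) // IsAbelianIdeal I})

instance (b : P.Base) [Finite ι] : Finite (AbelianIdeals b) :=
  inferInstanceAs (Finite {I : Set (PosRoot b) // IsAbelianIdeal I})

/-- The root system is of type `D_n`: its Cartan matrix with respect to the base `b` is, after an
enumeration of the simple roots, the Cartan matrix of type `D_n`. -/
def IsTypeD [P.IsCrystallographic] (b : P.Base) (n : ℕ) : Prop :=
  ∃ e : b.support ≃ Fin n, ∀ i j, b.cartanMatrix i j = CartanMatrix.D n (e i) (e j)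

end Roots

/-- The binomial coefficient with an integer lower index; it is zero for a negative one. -/
def binom (a : ℕ) (m : ℤ) : ℤ := if 0 ≤ m then (a.choose m.toNat : ℤ) else 0

end

/-! Positive roots are modelled by pairs `(a, c)`, standing for `ε_a - ε_c` with the convention
`ε_{2n-1-c} = -ε_c`. A cover in the poset of abelian ideals adds a single root (`covBy_iff_insert`,
`covBy_iff_erase`), so `κ(I)` counts the minimal roots of `I` and `ι(I)` the roots that can be added
to it.

The abelian ideals fall into three classes (`sum_dIdeals`). If `ε₀ - ε_{n-1}` is absent, `I`
consists of roots `ε_a + ε_b`, which never add up to a root, and is an arbitrary upper set of a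
staircase. If `ε₀ - ε_{n-1}` is present and `ε₀ + ε_{n-1}` is not, the diagram automorphism moves
`I` into the first class. If both are present, row 0 of `I` is everything from some column `m < n`
on; being abelian confines the other rows to columns `≥ 2n - m`, where again an arbitrary upper set
of a staircase may occur.

For staircases, removing a column or a row at the corner yields Pascal's rule split by parity,
`E_{N+1} = E_N + q O_N` and `O_{N+1} = O_N + E_N`. The generating functions are therefore even and
odd parts of binomial expansions (`sum_pow_card_stairMin`, `sum_pow_card_stairAdd`). Summing over
the classes and over `m` gives `E_n + q O_{n-1} + q O_{n-2} + q² E_{n-2}` and `O_n + q E_n`; the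
coefficient formulas follow.

An abstract root system is carried to the model by the linear map `coord` taking simple roots to
standard ones. Equality of Cartan matrices makes it injective and compatible with simple
reflections, whence `rootLabelling`. -/

noncomputable section

namespace TypeD

/-! ### Even and odd parts of the binomial expansion -/

/-- `∑ k, (N choose 2k) q ^ k`. -/
def evenPoly (N : ℕ) : ℤ[X] := ∑ k ∈ Finset.range (N + 1), C (N.choose (2 * k) : ℤ) * X ^ k

/-- `∑ k, (N choose (2k+1)) q ^ k`. -/
def oddPoly (N : ℕ) : ℤ[X] := ∑ k ∈ Finset.range (N + 1), C (N.choose (2 * k + 1) : ℤ) * X ^ k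

theorem evenPoly_coeff (N k : ℕ) : (evenPoly N).coeff k = N.choose (2 * k) := by
  simp only [evenPoly, finsetSum_coeff, coeff_C_mul_X_pow, Finset.sum_ite_eq, Finset.mem_range]
  split_ifs with h
  · rfl
  · rw [Nat.choose_eq_zero_of_lt (by omega)]; rfl

theorem oddPoly_coeff (N k : ℕ) : (oddPoly N).coeff k = N.choose (2 * k + 1) := by
  simp only [oddPoly, finsetSum_coeff, coeff_C_mul_X_pow, Finset.sum_ite_eq, Finset.mem_range]
  split_ifs with h
  · rfl
  · rw [Nat.choose_eq_zero_of_lt (by omega)]; rfl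

@[simp] theorem evenPoly_zero : evenPoly 0 = 1 := by simp [evenPoly]

@[simp] theorem oddPoly_zero : oddPoly 0 = 0 := by simp [oddPoly]

theorem evenPoly_succ (N : ℕ) : evenPoly (N + 1) = evenPoly N + X * oddPoly N := by
  ext k
  cases k with
  | zero => simp [evenPoly_coeff]
  | succ k =>
    rw [coeff_add, coeff_X_mul, evenPoly_coeff, evenPoly_coeff, oddPoly_coeff,
      show 2 * (k + 1) = 2 * k + 1 + 1 by ring, Nat.choose_succ_succ']
    push_cast
    ring

theorem oddPoly_succ (N : ℕ) : oddPoly (N + 1) = oddPoly N + evenPoly N := by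
  ext k
  rw [coeff_add, oddPoly_coeff, evenPoly_coeff, oddPoly_coeff, Nat.choose_succ_succ']
  push_cast
  ring

theorem sum_evenPoly (M : ℕ) : ∑ r ∈ Finset.range M, evenPoly r = oddPoly M := by
  induction M with
  | zero => simp
  | succ M ih => rw [Finset.sum_range_succ, ih, oddPoly_succ]

theorem sum_X_mul_oddPoly (M : ℕ) :
    ∑ r ∈ Finset.range M, X * oddPoly r = evenPoly M - 1 := by
  induction M with
  | zero => simp
  | succ M ih => rw [Finset.sum_range_succ, ih, evenPoly_succ]; ring

theorem binom_natCast (a m : ℕ) : binom a m = a.choose m := by simp [binom]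

theorem binom_of_neg (a : ℕ) {m : ℤ} (h : m < 0) : binom a m = 0 := by
  simp [binom, not_le.mpr h]

theorem evenPoly_coeff_eq_binom (N k : ℕ) : (evenPoly N).coeff k = binom N (2 * k) := by
  rw [evenPoly_coeff, ← binom_natCast]; norm_cast

theorem oddPoly_coeff_eq_binom (N k : ℕ) : (oddPoly N).coeff k = binom N (2 * k + 1) := by
  rw [oddPoly_coeff, ← binom_natCast]; norm_cast

theorem X_mul_evenPoly_coeff (N k : ℕ) : (X * evenPoly N).coeff k = binom N (2 * k - 2) := by
  cases k with
  | zero => simp [binom_of_neg]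
  | succ k =>
    rw [coeff_X_mul, evenPoly_coeff_eq_binom]
    congr 1
    push_cast
    ring

theorem X_mul_oddPoly_coeff (N k : ℕ) : (X * oddPoly N).coeff k = binom N (2 * k - 1) := by
  cases k with
  | zero => simp [binom_of_neg]
  | succ k =>
    rw [coeff_X_mul, oddPoly_coeff_eq_binom]
    congr 1
    push_cast
    ring

theorem X_sq_mul_evenPoly_coeff (N k : ℕ) :
    (X ^ 2 * evenPoly N).coeff k = binom N (2 * k - 4) := by
  rw [pow_two, mul_assoc]
  cases k with
  | zero => simp [binom_of_neg]
  | succ k =>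
    rw [coeff_X_mul, X_mul_evenPoly_coeff]
    congr 1
    push_cast
    ring

/-- The four coefficient formulas follow from closed forms of the two covering polynomials. -/
theorem coeff_formulas_of_closed_forms {n : ℕ} (hn : 3 ≤ n) {U L D : ℤ[X]}
    (hU : U = evenPoly n + X * oddPoly (n - 1) + X * oddPoly (n - 2) + X ^ 2 * evenPoly (n - 2))
    (hL : L = oddPoly n + X * evenPoly n) (hD : U - L = (X - 1) ^ 2 * D) :
    (∀ k : ℕ, U.coeff k = binom (n + 2) (2 * k) - 4 * binom (n - 1) (2 * k - 2)) ∧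
    (∀ k : ℕ, U.coeff k = binom n (2 * k) + binom (n - 1) (2 * k - 1) +
      binom (n - 2) (2 * k - 1) + binom (n - 2) (2 * k - 4)) ∧
    (∀ k : ℕ, L.coeff k = binom n (2 * k + 1) + binom n (2 * k - 2)) ∧
    (∀ k : ℕ, D.coeff k = -(binom (n - 2) (2 * k + 1) + binom (n - 3) (2 * k))) := by
  obtain ⟨m, rfl⟩ : ∃ m, n = m + 3 := ⟨n - 3, by omega⟩
  simp only [Nat.add_sub_cancel, show m + 3 - 1 = m + 2 by omega, show m + 3 - 2 = m + 1 by omega]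
    at *
  have hU' : U = evenPoly (m + 3 + 2) - C 4 * (X * evenPoly (m + 2)) := by
    rw [hU]
    simp only [evenPoly_succ, oddPoly_succ, map_ofNat]
    ring
  have hD' : D = -(oddPoly (m + 1) + evenPoly m) := by
    -- The factor `(X - 1) ^ 2` can be cancelled, so it suffices to multiply out the claimed
    -- quotient.
    have h0 : ((X - 1) ^ 2 : ℤ[X]) ≠ 0 := pow_ne_zero _ (X_sub_C_ne_zero (1 : ℤ))
    refine mul_left_cancel₀ h0 ?_
    rw [← hD, hU, hL]
    simp only [evenPoly_succ, oddPoly_succ]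
    ring
  refine ⟨fun k => ?_, fun k => ?_, fun k => ?_, fun k => ?_⟩
  · rw [hU', coeff_sub, coeff_C_mul, evenPoly_coeff_eq_binom, X_mul_evenPoly_coeff]
  · rw [hU, coeff_add, coeff_add, coeff_add, evenPoly_coeff_eq_binom, X_mul_oddPoly_coeff,
      X_mul_oddPoly_coeff, X_sq_mul_evenPoly_coeff]
  · rw [hL, coeff_add, oddPoly_coeff_eq_binom, X_mul_evenPoly_coeff]
  · rw [hD', coeff_neg, coeff_add, oddPoly_coeff_eq_binom, evenPoly_coeff_eq_binom]

/-! ### Ideals of a staircase -/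

open scoped Classical in
/-- The staircase `{(a, c) | lo ≤ a, c₀ ≤ c, a + c < L}`. -/
def stair (L lo c₀ : ℕ) : Finset (ℕ × ℕ) :=
  (Finset.range L ×ˢ Finset.range L).filter fun p => lo ≤ p.1 ∧ c₀ ≤ p.2 ∧ p.1 + p.2 < L

theorem mem_stair {L lo c₀ a c : ℕ} : (a, c) ∈ stair L lo c₀ ↔ lo ≤ a ∧ c₀ ≤ c ∧ a + c < L := by
  simp only [stair, Finset.mem_filter, Finset.mem_product, Finset.mem_range]
  omega

open scoped Classical in
/-- The subsets of a staircase that are closed under decreasing `a` and increasing `c`. -/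
def stairIdeals (L lo c₀ : ℕ) : Finset (Finset (ℕ × ℕ)) :=
  (stair L lo c₀).powerset.filter fun T =>
    (∀ a c, (a + 1, c) ∈ T → lo ≤ a → (a, c) ∈ T) ∧
      ∀ a c, (a, c) ∈ T → a + c + 1 < L → (a, c + 1) ∈ T

theorem mem_stairIdeals {L lo c₀ : ℕ} {T : Finset (ℕ × ℕ)} :
    T ∈ stairIdeals L lo c₀ ↔ (∀ a c, (a, c) ∈ T → lo ≤ a ∧ c₀ ≤ c ∧ a + c < L) ∧
      (∀ a c, (a + 1, c) ∈ T → lo ≤ a → (a, c) ∈ T) ∧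
      ∀ a c, (a, c) ∈ T → a + c + 1 < L → (a, c + 1) ∈ T := by
  simp only [stairIdeals, Finset.mem_filter, Finset.mem_powerset]
  refine and_congr_left fun _ => ⟨fun h a c hp => mem_stair.mp (h hp), fun h p hp => ?_⟩
  exact mem_stair.mpr (h p.1 p.2 hp)

open scoped Classical in
/-- The minimal elements of a staircase ideal. -/
def stairMin (T : Finset (ℕ × ℕ)) : Finset (ℕ × ℕ) :=
  T.filter fun p => (p.1 + 1, p.2) ∉ T ∧ ∀ c, c + 1 = p.2 → (p.1, c) ∉ T

theorem mem_stairMin {T : Finset (ℕ × ℕ)} {a c : ℕ} :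
    (a, c) ∈ stairMin T ↔ (a, c) ∈ T ∧ (a + 1, c) ∉ T ∧ ∀ d, d + 1 = c → (a, d) ∉ T := by
  simp [stairMin]

open scoped Classical in
/-- The elements that can be added to an ideal of the staircase. -/
def stairAdd (L lo c₀ : ℕ) (T : Finset (ℕ × ℕ)) : Finset (ℕ × ℕ) :=
  (stair L lo c₀).filter fun p => p ∉ T ∧ (∀ a, lo ≤ a → a + 1 = p.1 → (a, p.2) ∈ T) ∧
    (p.1 + p.2 + 1 < L → (p.1, p.2 + 1) ∈ T)

theorem mem_stairAdd {L lo c₀ : ℕ} {T : Finset (ℕ × ℕ)} {a c : ℕ} :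
    (a, c) ∈ stairAdd L lo c₀ T ↔ (lo ≤ a ∧ c₀ ≤ c ∧ a + c < L) ∧ (a, c) ∉ T ∧
      (∀ b, lo ≤ b → b + 1 = a → (b, c) ∈ T) ∧ (a + c + 1 < L → (a, c + 1) ∈ T) := by
  simp [stairAdd, mem_stair]

theorem stairIdeals_closed {L lo c₀ : ℕ} {T : Finset (ℕ × ℕ)} (hT : T ∈ stairIdeals L lo c₀)
    {a c b d : ℕ} (h : (a, c) ∈ T) (hb : lo ≤ b) (hba : b ≤ a) (hcd : c ≤ d) (hd : b + d < L) :
    (b, d) ∈ T := by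
  obtain ⟨-, h1, h2⟩ := mem_stairIdeals.mp hT
  have hb' : (b, c) ∈ T := by
    induction a, hba using Nat.le_induction with
    | base => exact h
    | succ a hba ih => exact ih (h1 a c h (by omega))
  induction d, hcd using Nat.le_induction with
  | base => exact hb'
  | succ d hcd ih => exact h2 b d (ih (by omega)) (by omega)

theorem stairIdeals_of_le {L lo c₀ : ℕ} (h : L ≤ lo + c₀) : stairIdeals L lo c₀ = {∅} := by
  ext T
  rw [mem_stairIdeals, Finset.mem_singleton]
  constructor
  · rintro ⟨h0, -, -⟩
    refine Finset.eq_empty_of_forall_notMem fun p hp => ?_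
    have := h0 p.1 p.2 hp
    omega
  · rintro rfl
    simp

/-! ### Corner recursion for staircase ideals -/

open scoped Classical in
-- Every cell of column `c₀` lies below the corner, so an ideal without the corner misses the whole
-- column.
theorem filter_corner_notMem (L lo c₀ : ℕ) :
    (stairIdeals L lo c₀).filter (fun T => (lo, c₀) ∉ T) = stairIdeals L lo (c₀ + 1) := by
  ext T
  rw [Finset.mem_filter]
  constructor
  · rintro ⟨hT, hc⟩
    obtain ⟨h0, h1, h2⟩ := mem_stairIdeals.mp hT
    refine mem_stairIdeals.mpr ⟨fun a c hac => ?_, h1, h2⟩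
    have h := h0 a c hac
    refine ⟨h.1, ?_, h.2.2⟩
    by_contra hlt
    obtain rfl : c = c₀ := by omega
    exact hc (stairIdeals_closed hT hac le_rfl h.1 le_rfl (by omega))
  · intro hT
    obtain ⟨h0, h1, h2⟩ := mem_stairIdeals.mp hT
    refine ⟨mem_stairIdeals.mpr ⟨fun a c hac => ?_, h1, h2⟩, fun h => ?_⟩
    · have := h0 a c hac
      omega
    · have := h0 _ _ h
      omega

open scoped Classical in
/-- Adding the full row `lo` to an ideal of the staircase that starts at `lo + 1`. -/
def addRow (L lo c₀ : ℕ) (T : Finset (ℕ × ℕ)) : Finset (ℕ × ℕ) :=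
  T ∪ (stair L lo c₀).filter fun p => p.1 = lo

theorem mem_addRow {L lo c₀ : ℕ} {T : Finset (ℕ × ℕ)} {a c : ℕ} :
    (a, c) ∈ addRow L lo c₀ T ↔ (a, c) ∈ T ∨ (a = lo ∧ c₀ ≤ c ∧ a + c < L) := by
  simp only [addRow, Finset.mem_union, Finset.mem_filter, mem_stair]
  refine or_congr_right ?_
  omega

theorem addRow_mem_stairIdeals {L lo c₀ : ℕ} {T : Finset (ℕ × ℕ)}
    (hT : T ∈ stairIdeals L (lo + 1) c₀) : addRow L lo c₀ T ∈ stairIdeals L lo c₀ := by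
  obtain ⟨h0, h1, h2⟩ := mem_stairIdeals.mp hT
  refine mem_stairIdeals.mpr ⟨fun a c hac => ?_, fun a c hac ha => ?_,
    fun a c hac ha => ?_⟩
  all_goals rw [mem_addRow] at *
  · rcases hac with hac | hac
    · have := h0 a c hac
      omega
    · omega
  · rcases hac with hac | hac
    · rcases eq_or_ne a lo with rfl | hne
      · have := h0 _ c hac
        right; omega
      · exact Or.inl (h1 a c hac (by omega))
    · omega
  · rcases hac with hac | hac
    · exact Or.inl (h2 a c hac ha)
    · right; omega

-- All of row `lo` lies above the corner, so an ideal with the corner contains that row and only its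
-- later rows are free.
open scoped Classical in
theorem sum_filter_corner_mem {L lo c₀ : ℕ} (h : lo + c₀ < L) (f : Finset (ℕ × ℕ) → ℤ[X]) :
    ∑ T ∈ (stairIdeals L lo c₀).filter (fun T => (lo, c₀) ∈ T), f T =
      ∑ T ∈ stairIdeals L (lo + 1) c₀, f (addRow L lo c₀ T) := by
  refine Finset.sum_nbij' (fun T => T.filter fun p => p.1 ≠ lo) (addRow L lo c₀) ?_ ?_ ?_ ?_ ?_
  · intro T hT
    rw [Finset.mem_filter] at hT
    obtain ⟨h0, h1, h2⟩ := mem_stairIdeals.mp hT.1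
    refine mem_stairIdeals.mpr ⟨fun a c hac => ?_, fun a c hac ha => ?_, fun a c hac ha => ?_⟩
    all_goals rw [Finset.mem_filter] at *
    · have := h0 a c hac.1
      have := hac.2
      simp only at this
      omega
    · exact ⟨h1 a c hac.1 (by omega), by simp only; omega⟩
    · exact ⟨h2 a c hac.1 (by omega), hac.2⟩
  · exact fun T hT => Finset.mem_filter.mpr ⟨addRow_mem_stairIdeals hT,
      mem_addRow.mpr (Or.inr ⟨rfl, le_rfl, h⟩)⟩
  · intro T hT
    rw [Finset.mem_filter] at hT
    obtain ⟨h0, h1, h2⟩ := mem_stairIdeals.mp hT.1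
    ext ⟨a, c⟩
    simp only [mem_addRow, Finset.mem_filter]
    constructor
    · rintro (h | ⟨rfl, h1, h2⟩)
      · exact h.1
      · exact stairIdeals_closed hT.1 hT.2 le_rfl le_rfl h1 h2
    · intro hac
      have := h0 a c hac
      rcases eq_or_ne a lo with rfl | hne
      · right; omega
      · exact Or.inl ⟨hac, hne⟩
  · intro T hT
    obtain ⟨h0, h1, h2⟩ := mem_stairIdeals.mp hT
    ext ⟨a, c⟩
    simp only [mem_addRow, Finset.mem_filter]
    constructor
    · rintro ⟨h | h, h'⟩
      · exact h
      · omega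
    · intro hac
      have := h0 a c hac
      exact ⟨Or.inl hac, by omega⟩
  · intro T hT
    rw [Finset.mem_filter] at hT
    obtain ⟨h0, h1, h2⟩ := mem_stairIdeals.mp hT.1
    congr 1
    ext ⟨a, c⟩
    simp only [mem_addRow, Finset.mem_filter]
    constructor
    · intro hac
      have := h0 a c hac
      rcases eq_or_ne a lo with rfl | hne
      · right; omega
      · exact Or.inl ⟨hac, hne⟩
    · rintro (h | ⟨rfl, h1, h2⟩)
      · exact h.1
      · exact stairIdeals_closed hT.1 hT.2 le_rfl le_rfl h1 h2

-- In the new row every cell except the corner has its left neighbour below it. The corner is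
-- minimal unless the cell `(lo + 1, c₀)` below it is present.
open scoped Classical in
theorem card_stairMin_addRow {L lo c₀ : ℕ} (h : lo + c₀ < L) {T : Finset (ℕ × ℕ)}
    (hT : T ∈ stairIdeals L (lo + 1) c₀) :
    (stairMin (addRow L lo c₀ T)).card =
      (stairMin T).card + if (lo + 1, c₀) ∈ T then 0 else 1 := by
  obtain ⟨h0, h1, h2⟩ := mem_stairIdeals.mp hT
  have key (a c : ℕ) : (a, c) ∈ stairMin (addRow L lo c₀ T) ↔
      (a, c) ∈ stairMin T ∨ ((a, c) = (lo, c₀) ∧ (lo + 1, c₀) ∉ T) := by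
    simp only [mem_stairMin, mem_addRow, Prod.mk.injEq]
    constructor
    · rintro ⟨h3 | h3, h4, h5⟩
      · exact Or.inl ⟨h3, fun h6 => h4 (Or.inl h6), fun d hd h6 => h5 d hd (Or.inl h6)⟩
      · obtain ⟨rfl, h6, h7⟩ := h3
        rcases eq_or_lt_of_le h6 with rfl | h8
        · exact Or.inr ⟨⟨rfl, rfl⟩, fun h => h4 (Or.inl h)⟩
        · exact absurd (Or.inr ⟨rfl, by omega, by omega⟩) (h5 (c - 1) (by omega))
    · rintro (⟨h3, h4, h5⟩ | ⟨⟨rfl, rfl⟩, h4⟩)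
      · have := h0 a c h3
        refine ⟨Or.inl h3, ?_, fun d hd => ?_⟩
        · rintro (h6 | h6)
          · exact h4 h6
          · omega
        · rintro (h6 | h6)
          · exact h5 d hd h6
          · omega
      · refine ⟨Or.inr ⟨rfl, le_rfl, h⟩, ?_, fun d hd => ?_⟩
        · rintro (h6 | h6)
          · exact h4 h6
          · omega
        · rintro (h6 | h6)
          · have := h0 _ _ h6
            omega
          · omega
  split_ifs with hc
  · rw [add_zero]
    congr 1
    ext ⟨a, c⟩
    rw [key]
    simp [hc]
  · rw [← Finset.card_insert_of_notMem (a := (lo, c₀)) (s := stairMin T)]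
    · congr 1
      ext ⟨a, c⟩
      rw [key, Finset.mem_insert]
      tauto
    · intro h3
      have := h0 _ _ (mem_stairMin.mp h3).1
      omega

/-- The condition that row `lo` imposes on row `lo + 1` is met by the full row, and is vacuous in
the staircase that starts at `lo + 1`. -/
theorem stairAdd_addRow {L lo c₀ : ℕ} {T : Finset (ℕ × ℕ)}
    (hT : T ∈ stairIdeals L (lo + 1) c₀) :
    stairAdd L lo c₀ (addRow L lo c₀ T) = stairAdd L (lo + 1) c₀ T := by
  obtain ⟨h0, h1, h2⟩ := mem_stairIdeals.mp hT
  ext ⟨a, c⟩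
  simp only [mem_stairAdd, mem_addRow]
  constructor
  · rintro ⟨h3, h4, h5, h6⟩
    push Not at h4
    refine ⟨by omega, h4.1, fun b hb hb' => ?_, fun h7 => ?_⟩
    · rcases h5 b (by omega) hb' with h8 | h8
      · exact h8
      · omega
    · rcases h6 h7 with h8 | h8
      · exact h8
      · omega
  · rintro ⟨h3, h4, h5, h6⟩
    refine ⟨by omega, ?_, fun b hb hb' => ?_, fun h7 => Or.inl (h6 h7)⟩
    · rintro (h7 | h7)
      · exact h4 h7
      · omega
    · rcases eq_or_ne b lo with rfl | hne
      · right; omega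
      · exact Or.inl (h5 b (by omega) hb')

-- Column `c₀` is empty, so only its corner can be added, namely when the right neighbour is present
-- or falls outside the staircase.
open scoped Classical in
theorem card_stairAdd_of_corner_notMem {L lo c₀ : ℕ} (h : lo + c₀ < L) {T : Finset (ℕ × ℕ)}
    (hT : T ∈ stairIdeals L lo (c₀ + 1)) :
    (stairAdd L lo c₀ T).card = (stairAdd L lo (c₀ + 1) T).card +
      if lo + c₀ + 1 < L ∧ (lo, c₀ + 1) ∉ T then 0 else 1 := by
  obtain ⟨h0, h1, h2⟩ := mem_stairIdeals.mp hT
  have key (a c : ℕ) : (a, c) ∈ stairAdd L lo c₀ T ↔ (a, c) ∈ stairAdd L lo (c₀ + 1) T ∨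
      ((a, c) = (lo, c₀) ∧ ¬ (lo + c₀ + 1 < L ∧ (lo, c₀ + 1) ∉ T)) := by
    simp only [mem_stairAdd, Prod.mk.injEq]
    constructor
    · rintro ⟨h3, h4, h5, h6⟩
      rcases eq_or_ne c c₀ with rfl | hne
      · have : a = lo := by
          by_contra hlo
          have := h0 _ _ (h5 (a - 1) (by omega) (by omega))
          omega
        subst this
        exact Or.inr ⟨⟨rfl, rfl⟩, fun h => h.2 (h6 h.1)⟩
      · exact Or.inl ⟨by omega, h4, h5, h6⟩
    · rintro (⟨h3, h4, h5, h6⟩ | ⟨⟨rfl, rfl⟩, h4⟩)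
      · exact ⟨by omega, h4, h5, h6⟩
      · refine ⟨by omega, fun h5 => ?_, fun b _ _ => by omega, fun h5 => ?_⟩
        · have := h0 _ _ h5
          omega
        · by_contra h6
          exact h4 ⟨h5, h6⟩
  split_ifs with hc
  · rw [add_zero]
    congr 1
    ext ⟨a, c⟩
    rw [key]
    simp [hc]
  · rw [← Finset.card_insert_of_notMem (a := (lo, c₀)) (s := stairAdd L lo (c₀ + 1) T)]
    · congr 1
      ext ⟨a, c⟩
      rw [key, Finset.mem_insert]
      tauto
    · intro h3
      have := (mem_stairAdd.mp h3).1
      omega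

/-! ### Generating functions of staircase ideals -/

open scoped Classical in
/-- The generating function of the number of minimal elements, refined by the corner. -/
theorem sum_pow_card_stairMin {L : ℕ} (N : ℕ) {lo c₀ : ℕ} (h : lo + c₀ + N = L) :
    ∑ T ∈ (stairIdeals L lo c₀).filter (fun T => (lo, c₀) ∉ T), (X : ℤ[X]) ^ (stairMin T).card =
      evenPoly N ∧
    ∑ T ∈ (stairIdeals L lo c₀).filter (fun T => (lo, c₀) ∈ T), (X : ℤ[X]) ^ (stairMin T).card =
      X * oddPoly N := by
  -- The two sums are proved together: each of them at `N + 1` is a combination of both at `N`, for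
  -- a staircase shrunk by a column or a row.
  induction N generalizing lo c₀ with
  | zero =>
    rw [stairIdeals_of_le (by omega)]
    simp [Finset.filter_singleton, stairMin]
  | succ N ih =>
    constructor
    · rw [filter_corner_notMem,
        ← Finset.sum_filter_not_add_sum_filter _ (fun T => (lo, c₀ + 1) ∈ T),
        (ih (by omega)).1, (ih (by omega)).2, evenPoly_succ]
    · rw [sum_filter_corner_mem (by omega), Finset.sum_congr rfl fun T hT => by
          rw [card_stairMin_addRow (by omega) hT, pow_add],
        ← Finset.sum_filter_not_add_sum_filter _ (fun T => (lo + 1, c₀) ∈ T)]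
      have e1 := (ih (lo := lo + 1) (c₀ := c₀) (by omega)).1
      have e2 := (ih (lo := lo + 1) (c₀ := c₀) (by omega)).2
      rw [oddPoly_succ, mul_add, ← e2, ← e1, Finset.mul_sum, add_comm]
      congr 1
      · refine Finset.sum_congr rfl fun T hT => ?_
        rw [if_pos (Finset.mem_filter.mp hT).2, pow_zero, mul_one]
      · refine Finset.sum_congr rfl fun T hT => ?_
        rw [if_neg (Finset.mem_filter.mp hT).2, pow_one, mul_comm]

theorem sum_pow_card_stairMin_total {L N lo c₀ : ℕ} (h : lo + c₀ + N = L + 1) :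
    ∑ T ∈ stairIdeals L lo c₀, (X : ℤ[X]) ^ (stairMin T).card = evenPoly N := by
  classical
  cases N with
  | zero =>
    rw [stairIdeals_of_le (by omega)]
    simp [stairMin]
  | succ N =>
    rw [← Finset.sum_filter_not_add_sum_filter _ (fun T => (lo, c₀) ∈ T),
      (sum_pow_card_stairMin N (by omega)).1, (sum_pow_card_stairMin N (by omega)).2,
      evenPoly_succ]

open scoped Classical in
/-- The generating function of the number of addable elements, refined by the corner. -/
theorem sum_pow_card_stairAdd {L : ℕ} (N : ℕ) {lo c₀ : ℕ} (h : lo + c₀ + N + 1 = L) :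
    ∑ T ∈ (stairIdeals L lo c₀).filter (fun T => (lo, c₀) ∉ T),
      (X : ℤ[X]) ^ (stairAdd L lo c₀ T).card = X * oddPoly (N + 1) ∧
    ∑ T ∈ (stairIdeals L lo c₀).filter (fun T => (lo, c₀) ∈ T),
      (X : ℤ[X]) ^ (stairAdd L lo c₀ T).card = evenPoly (N + 1) := by
  -- The induction starts at a one-cell staircase. For an empty staircase the first formula would
  -- read `X * oddPoly 0 = 0`, although the empty ideal contributes 1.
  induction N generalizing lo c₀ with
  | zero =>
    rw [filter_corner_notMem, sum_filter_corner_mem (by omega),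
      Finset.sum_congr rfl fun T hT => by rw [card_stairAdd_of_corner_notMem (by omega) hT],
      Finset.sum_congr (s₁ := stairIdeals L (lo + 1) c₀) rfl fun T hT => by
        rw [stairAdd_addRow hT],
      stairIdeals_of_le (by omega), stairIdeals_of_le (by omega)]
    have e1 : stairAdd L lo (c₀ + 1) ∅ = ∅ := by
      refine Finset.eq_empty_of_forall_notMem fun p hp => ?_
      have := (mem_stairAdd (a := p.1) (c := p.2).mp hp).1
      omega
    have e2 : stairAdd L (lo + 1) c₀ ∅ = ∅ := by
      refine Finset.eq_empty_of_forall_notMem fun p hp => ?_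
      have := (mem_stairAdd (a := p.1) (c := p.2).mp hp).1
      omega
    have e3 : ¬ lo + c₀ + 1 < L := by omega
    simp [e1, e2, e3, evenPoly_succ, oddPoly_succ]
  | succ N ih =>
    constructor
    · rw [filter_corner_notMem,
        Finset.sum_congr rfl fun T hT => by
          rw [card_stairAdd_of_corner_notMem (by omega) hT, pow_add],
        ← Finset.sum_filter_not_add_sum_filter _ (fun T => (lo, c₀ + 1) ∈ T)]
      have e1 := (ih (lo := lo) (c₀ := c₀ + 1) (by omega)).1
      have e2 := (ih (lo := lo) (c₀ := c₀ + 1) (by omega)).2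
      rw [oddPoly_succ, mul_add, ← e1, ← e2, Finset.mul_sum]
      refine congrArg₂ (· + ·) ?_ ?_
      · refine Finset.sum_congr rfl fun T hT => ?_
        rw [if_pos ⟨by omega, (Finset.mem_filter.mp hT).2⟩, pow_zero, mul_one]
      · refine Finset.sum_congr rfl fun T hT => ?_
        rw [if_neg fun h => h.2 (Finset.mem_filter.mp hT).2, pow_one, mul_comm]
    · rw [sum_filter_corner_mem (by omega), Finset.sum_congr rfl fun T hT => by
          rw [stairAdd_addRow hT],
        ← Finset.sum_filter_not_add_sum_filter _ (fun T => (lo + 1, c₀) ∈ T),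
        (ih (by omega)).1, (ih (by omega)).2, evenPoly_succ (N + 1)]
      ring

/-! ### A combinatorial model of the positive roots of type `D`

The pair `(a, c)` with `a < c` and `a + c < 2n - 1` stands for the root `εₐ - ε_c` if `c < n` and
for the root `εₐ + ε_{2n-1-c}` if `n ≤ c`. -/

open scoped Classical in
/-- The positive roots of type `D_n`. -/
def dRoots (n : ℕ) : Finset (ℕ × ℕ) :=
  (Finset.range (2 * n) ×ˢ Finset.range (2 * n)).filter fun p => p.1 < p.2 ∧ p.1 + p.2 + 1 < 2 * n

theorem mem_dRoots {n a c : ℕ} : (a, c) ∈ dRoots n ↔ a < c ∧ a + c + 1 < 2 * n := by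
  simp only [dRoots, Finset.mem_filter, Finset.mem_product, Finset.mem_range]
  omega

/-- `q - p` is a simple root. -/
def DStep (n : ℕ) (p q : ℕ × ℕ) : Prop :=
  (q.1 + 1 = p.1 ∧ q.2 = p.2) ∨ (q.1 = p.1 ∧ q.2 = p.2 + 1 ∧ p.2 + 1 ≠ n) ∨
    (q.1 = p.1 ∧ q.2 = p.2 + 2 ∧ (p.2 + 2 = n ∨ p.2 + 1 = n))

/-- `p + q` is a root. -/
def DSum (n : ℕ) (p q : ℕ × ℕ) : Prop :=
  (p.2 = q.1 ∧ p.1 + q.2 + 1 ≠ 2 * n) ∨ (q.2 = p.1 ∧ q.1 + p.2 + 1 ≠ 2 * n) ∨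
    (p.2 + q.2 + 1 = 2 * n ∧ p.1 ≠ q.1)

open scoped Classical in
/-- The abelian ideals of the model. -/
def dIdeals (n : ℕ) : Finset (Finset (ℕ × ℕ)) :=
  (dRoots n).powerset.filter fun I =>
    (∀ p ∈ I, ∀ q ∈ dRoots n, DStep n p q → q ∈ I) ∧ ∀ p ∈ I, ∀ q ∈ I, ¬ DSum n p q

theorem mem_dIdeals {n : ℕ} {I : Finset (ℕ × ℕ)} : I ∈ dIdeals n ↔ I ⊆ dRoots n ∧
    (∀ p ∈ I, ∀ q ∈ dRoots n, DStep n p q → q ∈ I) ∧ ∀ p ∈ I, ∀ q ∈ I, ¬ DSum n p q := by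
  simp [dIdeals]

open scoped Classical in
/-- The minimal elements of an ideal. -/
def dMin (n : ℕ) (I : Finset (ℕ × ℕ)) : Finset (ℕ × ℕ) :=
  I.filter fun p => ∀ q ∈ I, ¬ DStep n q p

theorem mem_dMin {n : ℕ} {I : Finset (ℕ × ℕ)} {p : ℕ × ℕ} :
    p ∈ dMin n I ↔ p ∈ I ∧ ∀ q ∈ I, ¬ DStep n q p := by
  simp [dMin]

open scoped Classical in
/-- The roots that can be added to an abelian ideal. -/
def dAdd (n : ℕ) (I : Finset (ℕ × ℕ)) : Finset (ℕ × ℕ) :=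
  (dRoots n).filter fun p =>
    p ∉ I ∧ (∀ q ∈ dRoots n, DStep n p q → q ∈ I) ∧ ∀ q ∈ I, ¬ DSum n p q

theorem mem_dAdd {n : ℕ} {I : Finset (ℕ × ℕ)} {p : ℕ × ℕ} : p ∈ dAdd n I ↔ p ∈ dRoots n ∧
    p ∉ I ∧ (∀ q ∈ dRoots n, DStep n p q → q ∈ I) ∧ ∀ q ∈ I, ¬ DSum n p q := by
  simp [dAdd]

/-! ### Ideals without `ε₀ - ε_{n-1}` -/

theorem dIdeals_row_zero {n : ℕ} {I : Finset (ℕ × ℕ)} (hI : I ∈ dIdeals n) {a c : ℕ}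
    (h : (a, c) ∈ I) : (0, c) ∈ I := by
  obtain ⟨h0, h1, -⟩ := mem_dIdeals.mp hI
  induction a with
  | zero => exact h
  | succ a ih =>
    have := mem_dRoots.mp (h0 h)
    exact ih (h1 _ h _ (mem_dRoots.mpr (by omega)) (Or.inl ⟨rfl, rfl⟩))

theorem dIdeals_mem_lower {n : ℕ} {I : Finset (ℕ × ℕ)} (hI : I ∈ dIdeals n) {a c d : ℕ}
    (h : (a, c) ∈ I) (hcd : c ≤ d) (hd : d < n) : (a, d) ∈ I := by
  obtain ⟨h0, h1, -⟩ := mem_dIdeals.mp hI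
  have h2 := mem_dRoots.mp (h0 h)
  induction d, hcd using Nat.le_induction with
  | base => exact h
  | succ d hcd ih =>
    exact h1 _ (ih (by omega)) _ (mem_dRoots.mpr (by omega))
      (Or.inr (Or.inl ⟨rfl, rfl, by simp only; omega⟩))

theorem dIdeals_mem_upper {n : ℕ} {I : Finset (ℕ × ℕ)} (hI : I ∈ dIdeals n) {a c d : ℕ}
    (h : (a, c) ∈ I) (hc : n ≤ c) (hcd : c ≤ d) (hd : a + d + 1 < 2 * n) : (a, d) ∈ I := by
  obtain ⟨h0, h1, -⟩ := mem_dIdeals.mp hI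
  have h2 := mem_dRoots.mp (h0 h)
  induction d, hcd using Nat.le_induction with
  | base => exact h
  | succ d hcd ih =>
    exact h1 _ (ih (by omega)) _ (mem_dRoots.mpr (by omega))
      (Or.inr (Or.inl ⟨rfl, rfl, by simp only; omega⟩))

-- From a root in a column `c < n` one climbs to `(0, n - 1)`, so only columns `≥ n` remain. There
-- no two roots have a root as their sum, and the abelian condition is automatic.
open scoped Classical in
theorem filter_dIdeals_notMem {n : ℕ} (hn : 3 ≤ n) :
    (dIdeals n).filter (fun I => (0, n - 1) ∉ I) = stairIdeals (2 * n - 1) 0 n := by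
  ext I
  rw [Finset.mem_filter]
  constructor
  · rintro ⟨hI, hc⟩
    obtain ⟨h0, h1, -⟩ := mem_dIdeals.mp hI
    refine mem_stairIdeals.mpr ⟨fun a c hac => ?_, fun a c hac _ => ?_, fun a c hac h => ?_⟩
    · have h2 := mem_dRoots.mp (h0 hac)
      refine ⟨Nat.zero_le _, ?_, by omega⟩
      by_contra h3
      exact hc (dIdeals_row_zero hI (dIdeals_mem_lower hI hac (d := n - 1) (by omega) (by omega)))
    · have h2 := mem_dRoots.mp (h0 hac)
      exact h1 _ hac _ (mem_dRoots.mpr (by omega)) (Or.inl ⟨rfl, rfl⟩)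
    · have h2 := mem_dRoots.mp (h0 hac)
      have h3 : n ≤ c := by
        by_contra h3
        exact hc (dIdeals_row_zero hI
          (dIdeals_mem_lower hI hac (d := n - 1) (by omega) (by omega)))
      exact dIdeals_mem_upper hI hac h3 (by omega) (by omega)
  · intro hI
    obtain ⟨h0, h1, h2⟩ := mem_stairIdeals.mp hI
    refine ⟨mem_dIdeals.mpr ⟨fun p hp => ?_, fun p hp q hq hpq => ?_, fun p hp q hq hpq => ?_⟩,
      fun h => ?_⟩
    · have := h0 p.1 p.2 hp
      exact mem_dRoots.mpr (by omega)
    · obtain ⟨a, c⟩ := p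
      obtain ⟨b, d⟩ := q
      have h3 := h0 a c hp
      have h4 := mem_dRoots.mp hq
      simp only [DStep] at hpq
      exact stairIdeals_closed hI hp (by omega) (by omega) (by omega) (by omega)
    · have h3 := h0 p.1 p.2 hp
      have h4 := h0 q.1 q.2 hq
      simp only [DSum] at hpq
      omega
    · have := h0 _ _ h
      omega

/-! #### The diagram automorphism -/

/-- The involution that changes the sign of `ε_{n-1}`. -/
def twist (n : ℕ) : Equiv.Perm (ℕ × ℕ) := (Equiv.refl ℕ).prodCongr (Equiv.swap (n - 1) n)

theorem twist_apply (n a c : ℕ) : twist n (a, c) = (a, Equiv.swap (n - 1) n c) := rfl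

@[simp] theorem twist_twist (n : ℕ) (p : ℕ × ℕ) : twist n (twist n p) = p := by
  obtain ⟨a, c⟩ := p
  simp [twist_apply]

theorem twist_mem_dRoots {n : ℕ} {p : ℕ × ℕ} : twist n p ∈ dRoots n ↔ p ∈ dRoots n := by
  obtain ⟨a, c⟩ := p
  rw [twist_apply, mem_dRoots, mem_dRoots, Equiv.swap_apply_def]
  split_ifs <;> omega

theorem DStep_twist {n : ℕ} (hn : 3 ≤ n) {p q : ℕ × ℕ} :
    DStep n (twist n p) (twist n q) ↔ DStep n p q := by
  obtain ⟨a, c⟩ := p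
  obtain ⟨b, d⟩ := q
  simp only [DStep, twist_apply, Equiv.swap_apply_def]
  split_ifs <;> omega

/-- The first index of a root is at most `n - 2`, so swapping `n - 1` and `n` does not disturb
matches between a first and a second index. Matches of two second indices survive because the swap
commutes with `c ↦ 2n - 1 - c`. -/
theorem DSum_twist {n : ℕ} (hn : 3 ≤ n) {p q : ℕ × ℕ} (hp : p ∈ dRoots n) (hq : q ∈ dRoots n) :
    DSum n (twist n p) (twist n q) ↔ DSum n p q := by
  obtain ⟨a, c⟩ := p
  obtain ⟨b, d⟩ := q
  rw [mem_dRoots] at hp hq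
  simp only [DSum, twist_apply, Equiv.swap_apply_def]
  split_ifs <;> omega

/-- The twist of a set of roots. -/
def twistSet (n : ℕ) (I : Finset (ℕ × ℕ)) : Finset (ℕ × ℕ) := I.map (twist n).toEmbedding

theorem mem_twistSet {n : ℕ} {I : Finset (ℕ × ℕ)} {p : ℕ × ℕ} :
    p ∈ twistSet n I ↔ twist n p ∈ I := by
  simp only [twistSet, Finset.mem_map, Equiv.coe_toEmbedding]
  constructor
  · rintro ⟨q, hq, rfl⟩
    rwa [twist_twist]
  · intro h
    exact ⟨_, h, twist_twist n p⟩

theorem twistSet_twistSet (n : ℕ) (I : Finset (ℕ × ℕ)) : twistSet n (twistSet n I) = I := by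
  ext p
  simp [mem_twistSet]

theorem twistSet_mem_dIdeals {n : ℕ} (hn : 3 ≤ n) {I : Finset (ℕ × ℕ)} (hI : I ∈ dIdeals n) :
    twistSet n I ∈ dIdeals n := by
  obtain ⟨h0, h1, h2⟩ := mem_dIdeals.mp hI
  refine mem_dIdeals.mpr ⟨fun p hp => ?_, fun p hp q hq hpq => ?_, fun p hp q hq hpq => ?_⟩
  all_goals rw [mem_twistSet] at *
  · exact twist_mem_dRoots.mp (h0 hp)
  · exact h1 _ hp _ (twist_mem_dRoots.mpr hq) ((DStep_twist hn).mpr hpq)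
  · exact h2 _ hp _ hq ((DSum_twist hn (twist_mem_dRoots.mp (h0 hp))
      (twist_mem_dRoots.mp (h0 hq))).mpr hpq)

theorem card_dMin_twistSet {n : ℕ} (hn : 3 ≤ n) (I : Finset (ℕ × ℕ)) :
    (dMin n (twistSet n I)).card = (dMin n I).card := by
  have : dMin n (twistSet n I) = twistSet n (dMin n I) := by
    ext p
    simp only [mem_dMin, mem_twistSet]
    refine and_congr_right fun _ => ⟨fun h q hq hs => ?_, fun h q hq hs => ?_⟩
    · refine h (twist n q) (by rwa [twist_twist]) ?_
      rw [← DStep_twist hn, twist_twist]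
      exact hs
    · exact h _ hq ((DStep_twist hn).mpr hs)
  rw [this, twistSet, Finset.card_map]

theorem card_dAdd_twistSet {n : ℕ} (hn : 3 ≤ n) {I : Finset (ℕ × ℕ)} (hI : I ⊆ dRoots n) :
    (dAdd n (twistSet n I)).card = (dAdd n I).card := by
  have : dAdd n (twistSet n I) = twistSet n (dAdd n I) := by
    ext p
    simp only [mem_dAdd, mem_twistSet, twist_mem_dRoots]
    refine and_congr_right fun hp => and_congr_right fun _ =>
      and_congr ⟨fun h q hq hs => ?_, fun h q hq hs => ?_⟩
        ⟨fun h q hq hs => ?_, fun h q hq hs => ?_⟩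
    · have := h (twist n q) (twist_mem_dRoots.mpr hq) (by
        rw [← DStep_twist hn, twist_twist]
        exact hs)
      rwa [twist_twist] at this
    · exact h _ (twist_mem_dRoots.mpr hq) ((DStep_twist hn).mpr hs)
    · refine h (twist n q) (by rwa [twist_twist]) ?_
      rw [← DSum_twist hn hp (twist_mem_dRoots.mpr (hI hq)), twist_twist]
      exact hs
    · exact h _ hq ((DSum_twist hn hp (twist_mem_dRoots.mp (hI hq))).mpr hs)
  rw [this, twistSet, Finset.card_map]

-- The twist exchanges `(0, n - 1)` and `(0, n)`, so this class corresponds to the staircase ideals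
-- that contain their corner.
open scoped Classical in
theorem sum_filter_dIdeals_twist {n : ℕ} (hn : 3 ≤ n) (f : Finset (ℕ × ℕ) → ℤ[X]) :
    ∑ I ∈ (dIdeals n).filter (fun I => (0, n - 1) ∈ I ∧ (0, n) ∉ I), f I =
      ∑ T ∈ (stairIdeals (2 * n - 1) 0 n).filter (fun T => (0, n) ∈ T), f (twistSet n T) := by
  have e1 : twist n (0, n - 1) = (0, n) := by simp [twist_apply]
  have e2 : twist n (0, n) = (0, n - 1) := by simp [twist_apply]
  rw [← filter_dIdeals_notMem hn]
  refine Finset.sum_nbij' (twistSet n) (twistSet n) ?_ ?_ ?_ ?_ ?_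
  · intro I hI
    simp only [Finset.mem_filter, mem_twistSet, e1, e2] at *
    exact ⟨⟨twistSet_mem_dIdeals hn hI.1, hI.2.2⟩, hI.2.1⟩
  · intro I hI
    simp only [Finset.mem_filter, mem_twistSet, e1, e2] at *
    exact ⟨twistSet_mem_dIdeals hn hI.1.1, hI.2, hI.1.2⟩
  · exact fun I _ => twistSet_twistSet n I
  · exact fun I _ => twistSet_twistSet n I
  · exact fun I _ => by rw [twistSet_twistSet]

/-! #### Ideals containing both `ε₀ - ε_{n-1}` and `ε₀ + ε_{n-1}` -/

theorem addRow_mem_dIdeals {n m : ℕ} (hm : 1 ≤ m) (hmn : m < n) {T : Finset (ℕ × ℕ)}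
    (hT : T ∈ stairIdeals (2 * n - 1) 1 (2 * n - m)) : addRow (2 * n - 1) 0 m T ∈ dIdeals n := by
  obtain ⟨h0, h1, h2⟩ := mem_stairIdeals.mp hT
  refine mem_dIdeals.mpr ⟨?_, ?_, ?_⟩
  · rintro ⟨a, c⟩ hp
    rw [mem_dRoots]
    rcases mem_addRow.mp hp with h | h
    · have := h0 _ _ h
      omega
    · omega
  · rintro ⟨a, c⟩ hp ⟨b, d⟩ hq hs
    simp only [DStep] at hs
    rw [mem_dRoots] at hq
    rw [mem_addRow] at *
    rcases hp with h | h
    · have h3 := h0 _ _ h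
      rcases Nat.eq_zero_or_pos b with rfl | hb
      · right; omega
      · exact Or.inl (stairIdeals_closed hT h hb (by omega) (by omega) (by omega))
    · right; omega
  · rintro ⟨a, c⟩ hp ⟨b, d⟩ hq hs
    simp only [DSum] at hs
    rw [mem_addRow] at *
    have h3 : (1 ≤ a ∧ 2 * n - m ≤ c ∧ a + c < 2 * n - 1) ∨ (a = 0 ∧ m ≤ c ∧ a + c < 2 * n - 1) :=
      hp.imp_left (h0 _ _)
    have h4 : (1 ≤ b ∧ 2 * n - m ≤ d ∧ b + d < 2 * n - 1) ∨ (b = 0 ∧ m ≤ d ∧ b + d < 2 * n - 1) :=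
      hq.imp_left (h0 _ _)
    omega

open scoped Classical in
theorem exists_addRow_eq {n : ℕ} (hn : 3 ≤ n) {I : Finset (ℕ × ℕ)} (hI : I ∈ dIdeals n)
    (hI1 : (0, n - 1) ∈ I) (hI2 : (0, n) ∈ I) : ∃ m, 1 ≤ m ∧ m < n ∧
      ∃ T ∈ stairIdeals (2 * n - 1) 1 (2 * n - m), addRow (2 * n - 1) 0 m T = I := by
  obtain ⟨h0, h1, h2⟩ := mem_dIdeals.mp hI
  have hex : ∃ c, (0, c) ∈ I := ⟨_, hI1⟩
  set m := Nat.find hex with hm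
  have hm0 : (0, m) ∈ I := Nat.find_spec hex
  have hmn : m ≤ n - 1 := Nat.find_min' hex hI1
  have hm1 := mem_dRoots.mp (h0 hm0)
  have hrow (c : ℕ) : (0, c) ∈ I ↔ m ≤ c ∧ c + 1 < 2 * n := by
    constructor
    · intro h
      have := mem_dRoots.mp (h0 h)
      exact ⟨Nat.find_min' hex h, by omega⟩
    · rintro ⟨h3, h4⟩
      -- There is no step from column `n - 1` to column `n`, so the right half of the row is started
      -- afresh from `hI2`.
      rcases lt_or_ge c n with h | h
      · exact dIdeals_mem_lower hI hm0 h3 h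
      · exact dIdeals_mem_upper hI hI2 le_rfl h (by omega)
  -- Otherwise `(0, 2n - 1 - c)`, which is `ε₀ + ε_c`, lies in row 0 of `I`, and its sum with `ε_a -
  -- ε_c` is the root `ε₀ + ε_a`.
  have hpos (a c : ℕ) (ha : a ≠ 0) (h : (a, c) ∈ I) : 2 * n - m ≤ c := by
    by_contra hc
    have h3 := mem_dRoots.mp (h0 h)
    refine h2 _ h (0, 2 * n - 1 - c) ((hrow _).mpr (by omega)) (Or.inr (Or.inr ?_))
    simp only
    omega
  refine ⟨m, by omega, by omega, I.filter fun p => p.1 ≠ 0, mem_stairIdeals.mpr ⟨?_, ?_, ?_⟩, ?_⟩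
  · intro a c h
    rw [Finset.mem_filter] at h
    have h3 := mem_dRoots.mp (h0 h.1)
    have h4 := hpos a c h.2 h.1
    have h5 : a ≠ 0 := h.2
    omega
  · intro a c h ha
    rw [Finset.mem_filter] at *
    have h3 := mem_dRoots.mp (h0 h.1)
    exact ⟨h1 _ h.1 _ (mem_dRoots.mpr (by omega)) (Or.inl ⟨rfl, rfl⟩), by simp only; omega⟩
  · intro a c h ha
    rw [Finset.mem_filter] at *
    have h3 := mem_dRoots.mp (h0 h.1)
    have h4 := hpos a c h.2 h.1
    exact ⟨dIdeals_mem_upper hI h.1 (by omega) (by omega) (by omega), h.2⟩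
  · ext ⟨a, c⟩
    rw [mem_addRow, Finset.mem_filter]
    rcases eq_or_ne a 0 with rfl | ha
    · rw [hrow]
      simp only [ne_eq, not_true, and_false, false_or, true_and]
      omega
    · simp [ha]

theorem addRow_injective {n m m' : ℕ} (hmn : m < n) (hmn' : m' < n)
    {T T' : Finset (ℕ × ℕ)} (hT : T ∈ stairIdeals (2 * n - 1) 1 (2 * n - m))
    (hT' : T' ∈ stairIdeals (2 * n - 1) 1 (2 * n - m'))
    (h : addRow (2 * n - 1) 0 m T = addRow (2 * n - 1) 0 m' T') : m = m' ∧ T = T' := by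
  have h0 := (mem_stairIdeals.mp hT).1
  have h0' := (mem_stairIdeals.mp hT').1
  have key (a c : ℕ) : ((a, c) ∈ T ∨ (a = 0 ∧ m ≤ c ∧ a + c < 2 * n - 1)) ↔
      ((a, c) ∈ T' ∨ (a = 0 ∧ m' ≤ c ∧ a + c < 2 * n - 1)) := by
    rw [← mem_addRow, ← mem_addRow, h]
  have zero (c : ℕ) : (0, c) ∉ T := fun h => by have := h0 _ _ h; omega
  have zero' (c : ℕ) : (0, c) ∉ T' := fun h => by have := h0' _ _ h; omega
  constructor
  · have h1 := ((key 0 m).mp (Or.inr ⟨rfl, le_rfl, by omega⟩)).resolve_left (zero' m)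
    have h2 := ((key 0 m').mpr (Or.inr ⟨rfl, le_rfl, by omega⟩)).resolve_left (zero m')
    omega
  · ext ⟨a, c⟩
    rcases eq_or_ne a 0 with rfl | ha
    · simp [zero, zero']
    · simpa [ha] using key a c

open scoped Classical in
theorem sum_filter_dIdeals_addRow {n : ℕ} (hn : 3 ≤ n) (f : Finset (ℕ × ℕ) → ℤ[X]) :
    ∑ I ∈ (dIdeals n).filter (fun I => (0, n - 1) ∈ I ∧ (0, n) ∈ I), f I =
      ∑ m ∈ Finset.Ico 1 n, ∑ T ∈ stairIdeals (2 * n - 1) 1 (2 * n - m),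
        f (addRow (2 * n - 1) 0 m T) := by
  rw [Finset.sum_sigma']
  symm
  refine Finset.sum_nbij (fun x => addRow (2 * n - 1) 0 x.1 x.2) ?_ ?_ ?_ fun _ _ => rfl
  · rintro ⟨m, T⟩ h
    simp only [Finset.mem_sigma, Finset.mem_Ico] at h
    refine Finset.mem_filter.mpr ⟨addRow_mem_dIdeals h.1.1 h.1.2 h.2, ?_⟩
    exact ⟨mem_addRow.mpr (Or.inr ⟨rfl, by dsimp only; omega⟩),
      mem_addRow.mpr (Or.inr ⟨rfl, by dsimp only; omega⟩)⟩
  · rintro ⟨m, T⟩ h ⟨m', T'⟩ h' heq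
    simp only [Finset.coe_sigma, Set.mem_sigma_iff, Finset.mem_coe, Finset.mem_Ico] at h h'
    obtain ⟨rfl, rfl⟩ := addRow_injective h.1.2 h'.1.2 h.2 h'.2 heq
    rfl
  · intro I hI
    rw [Finset.mem_coe, Finset.mem_filter] at hI
    obtain ⟨m, h1, h2, T, hT, h⟩ := exists_addRow_eq hn hI.1 hI.2.1 hI.2.2
    refine ⟨⟨m, T⟩, ?_, h⟩
    simp only [Finset.coe_sigma, Set.mem_sigma_iff, Finset.mem_coe, Finset.mem_Ico]
    exact ⟨⟨h1, h2⟩, hT⟩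

open scoped Classical in
theorem sum_dIdeals {n : ℕ} (hn : 3 ≤ n) (f : Finset (ℕ × ℕ) → ℤ[X]) :
    ∑ I ∈ dIdeals n, f I = ∑ T ∈ stairIdeals (2 * n - 1) 0 n, f T +
      (∑ T ∈ (stairIdeals (2 * n - 1) 0 n).filter (fun T => (0, n) ∈ T), f (twistSet n T) +
      ∑ m ∈ Finset.Ico 1 n, ∑ T ∈ stairIdeals (2 * n - 1) 1 (2 * n - m),
        f (addRow (2 * n - 1) 0 m T)) := by
  rw [← sum_filter_dIdeals_twist hn, ← sum_filter_dIdeals_addRow hn, ← filter_dIdeals_notMem hn,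
    ← Finset.sum_filter_not_add_sum_filter (dIdeals n) (fun I => (0, n - 1) ∈ I),
    ← Finset.sum_filter_not_add_sum_filter ((dIdeals n).filter fun I => (0, n - 1) ∈ I)
      (fun I => (0, n) ∈ I), Finset.filter_filter, Finset.filter_filter]

/-! ### Minimal and addable roots of the abelian ideals of the model -/

theorem dMin_of_mem_stairIdeals {n : ℕ} {T : Finset (ℕ × ℕ)}
    (hT : T ∈ stairIdeals (2 * n - 1) 0 n) : dMin n T = stairMin T := by
  obtain ⟨h0, -, -⟩ := mem_stairIdeals.mp hT
  ext ⟨a, c⟩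
  rw [mem_dMin, mem_stairMin]
  refine and_congr_right fun h => ⟨fun h1 => ⟨fun h2 => ?_, fun d hd h2 => ?_⟩, ?_⟩
  · exact h1 _ h2 (Or.inl ⟨rfl, rfl⟩)
  · have := h0 _ _ h2
    exact h1 _ h2 (Or.inr (Or.inl ⟨rfl, hd.symm, by simp only; omega⟩))
  · rintro ⟨h1, h2⟩ ⟨b, d⟩ hq hs
    have := h0 _ _ hq
    simp only [DStep] at hs
    rcases hs with ⟨rfl, rfl⟩ | ⟨rfl, rfl, -⟩ | hs
    · exact h1 hq
    · exact h2 _ rfl hq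
    · omega

-- Outside the staircase only `(0, n - 1)` can be added. Its single upper neighbour is `(0, n + 1)`;
-- it clashes with the roots `(a, n)`, `a ≥ 1`, and if `T` contains one of these it contains `(1,
-- n)`.
open scoped Classical in
theorem card_dAdd_of_mem_stairIdeals {n : ℕ} (hn : 3 ≤ n) {T : Finset (ℕ × ℕ)}
    (hT : T ∈ stairIdeals (2 * n - 1) 0 n) : (dAdd n T).card =
      (stairAdd (2 * n - 1) 0 n T).card + if (0, n + 1) ∈ T ∧ (1, n) ∉ T then 1 else 0 := by
  obtain ⟨h0, -, -⟩ := mem_stairIdeals.mp hT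
  have key (a c : ℕ) : (a, c) ∈ dAdd n T ↔ (a, c) ∈ stairAdd (2 * n - 1) 0 n T ∨
      ((a, c) = (0, n - 1) ∧ (0, n + 1) ∈ T ∧ (1, n) ∉ T) := by
    rw [mem_dAdd, mem_stairAdd, mem_dRoots, Prod.mk.injEq]
    constructor
    · rintro ⟨h1, h2, h3, h4⟩
      rcases le_or_gt n c with hc | hc
      · refine Or.inl ⟨by omega, h2, fun b _ hb => ?_, fun h => ?_⟩
        · exact h3 (b, c) (mem_dRoots.mpr (by omega)) (Or.inl ⟨hb, rfl⟩)
        · exact h3 (a, c + 1) (mem_dRoots.mpr (by omega))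
            (Or.inr (Or.inl ⟨rfl, rfl, by simp only; omega⟩))
      · right
        have ha : a = 0 := by
          by_contra ha
          have := h0 _ _ (h3 (a - 1, c) (mem_dRoots.mpr (by omega))
            (Or.inl ⟨by simp only; omega, rfl⟩))
          omega
        subst ha
        have hc' : c = n - 1 := by
          by_contra hc'
          have := h0 _ _ (h3 (0, c + 1) (mem_dRoots.mpr (by omega))
            (Or.inr (Or.inl ⟨rfl, rfl, by simp only; omega⟩)))
          omega
        subst hc'
        refine ⟨⟨rfl, rfl⟩, ?_, fun h => ?_⟩
        · exact h3 (0, n + 1) (mem_dRoots.mpr (by omega))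
            (Or.inr (Or.inr ⟨rfl, by simp only; omega, by simp only; omega⟩))
        · exact h4 _ h (Or.inr (Or.inr ⟨by simp only; omega, by simp⟩))
    · rintro (⟨h1, h2, h3, h4⟩ | ⟨⟨rfl, rfl⟩, h1, h2⟩)
      · refine ⟨by omega, h2, ?_, ?_⟩
        · rintro ⟨b, d⟩ hq hs
          rw [mem_dRoots] at hq
          simp only [DStep] at hs
          rcases hs with ⟨rfl, rfl⟩ | ⟨rfl, rfl, -⟩ | hs
          · exact h3 _ (Nat.zero_le _) rfl
          · exact h4 (by omega)
          · omega
        · rintro ⟨b, d⟩ hq hs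
          have := h0 _ _ hq
          simp only [DSum] at hs
          omega
      · refine ⟨by omega, fun h => ?_, ?_, ?_⟩
        · have := h0 _ _ h
          omega
        · rintro ⟨b, d⟩ hq hs
          simp only [DStep] at hs
          obtain ⟨rfl, rfl⟩ : b = 0 ∧ d = n + 1 := by omega
          exact h1
        · rintro ⟨b, d⟩ hq hs
          have := h0 _ _ hq
          simp only [DSum] at hs
          obtain rfl : d = n := by omega
          exact h2 (stairIdeals_closed hT hq (by omega) (by omega) le_rfl (by omega))
  split_ifs with hc
  · rw [← Finset.card_insert_of_notMem (a := (0, n - 1))]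
    · congr 1
      ext ⟨a, c⟩
      rw [key, Finset.mem_insert]
      tauto
    · intro h3
      have := (mem_stairAdd.mp h3).1
      omega
  · rw [add_zero]
    congr 1
    ext ⟨a, c⟩
    rw [key]
    tauto

/-- The first root `(0, m)` of the row is always minimal. The root `(0, n)` sits in row 0 directly
above `(0, n - 2)` and not above `(0, n - 1)`, so it is minimal too when the row starts at `n - 1`.
-/
theorem card_dMin_addRow {n m : ℕ} (hm : 1 ≤ m) (hmn : m < n) {T : Finset (ℕ × ℕ)}
    (hT : T ∈ stairIdeals (2 * n - 1) 1 (2 * n - m)) :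
    (dMin n (addRow (2 * n - 1) 0 m T)).card =
      (stairMin T).card + 1 + if m + 1 = n then 1 else 0 := by
  classical
  obtain ⟨h0, -, -⟩ := mem_stairIdeals.mp hT
  have key (a c : ℕ) : (a, c) ∈ dMin n (addRow (2 * n - 1) 0 m T) ↔ (a, c) ∈ stairMin T ∨
      (a, c) = (0, m) ∨ (m + 1 = n ∧ (a, c) = (0, n)) := by
    rw [mem_dMin, mem_stairMin, Prod.mk.injEq, Prod.mk.injEq]
    constructor
    · rintro ⟨h1, h2⟩
      rcases mem_addRow.mp h1 with h | h
      · refine Or.inl ⟨h, fun h3 => ?_, fun d hd h3 => ?_⟩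
        · exact h2 _ (mem_addRow.mpr (Or.inl h3)) (Or.inl ⟨rfl, rfl⟩)
        · have := h0 _ _ h3
          exact h2 _ (mem_addRow.mpr (Or.inl h3))
            (Or.inr (Or.inl ⟨rfl, hd.symm, by simp only; omega⟩))
      · right
        obtain ⟨rfl, h3, h4⟩ := h
        by_contra hne
        rcases eq_or_ne c n with rfl | hc
        · exact h2 (0, c - 2) (mem_addRow.mpr (Or.inr ⟨rfl, by omega, by omega⟩))
            (Or.inr (Or.inr ⟨rfl, by simp only; omega, by simp only; omega⟩))
        · exact h2 (0, c - 1) (mem_addRow.mpr (Or.inr ⟨rfl, by omega, by omega⟩))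
            (Or.inr (Or.inl ⟨rfl, by simp only; omega, by simp only; omega⟩))
    · rintro (⟨h1, h2, h3⟩ | ⟨rfl, rfl⟩ | ⟨rfl, rfl, rfl⟩)
      · have h4 := h0 _ _ h1
        refine ⟨mem_addRow.mpr (Or.inl h1), ?_⟩
        rintro ⟨b, d⟩ hq hs
        simp only [DStep] at hs
        have hq' : (b, d) ∈ T := (mem_addRow.mp hq).resolve_right (by omega)
        have h5 := h0 _ _ hq'
        rcases hs with ⟨rfl, rfl⟩ | ⟨rfl, rfl, -⟩ | hs
        · exact h2 hq'
        · exact h3 _ rfl hq'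
        · omega
      · refine ⟨mem_addRow.mpr (Or.inr (by omega)), ?_⟩
        rintro ⟨b, d⟩ hq hs
        simp only [DStep] at hs
        rcases mem_addRow.mp hq with h | h
        · have := h0 _ _ h
          omega
        · omega
      · refine ⟨mem_addRow.mpr (Or.inr (by omega)), ?_⟩
        rintro ⟨b, d⟩ hq hs
        simp only [DStep] at hs
        rcases mem_addRow.mp hq with h | h
        · have := h0 _ _ h
          omega
        · omega
  have hz (c : ℕ) : (0, c) ∉ stairMin T := fun h => by
    have := h0 _ _ (mem_stairMin.mp h).1
    omega
  rw [← Finset.card_insert_of_notMem (hz m)]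
  split_ifs with h
  · rw [← Finset.card_insert_of_notMem (a := (0, n))]
    · congr 1
      ext ⟨a, c⟩
      rw [key, Finset.mem_insert, Finset.mem_insert]
      tauto
    · rw [Finset.mem_insert, Prod.mk.injEq]
      rintro (h1 | h1)
      · omega
      · exact hz n h1
  · rw [add_zero]
    congr 1
    ext ⟨a, c⟩
    rw [key, Finset.mem_insert]
    tauto

-- Row 0 can grow only by `(0, m - 1)`, which clashes with column `2n - m`. In the other rows, a
-- root left of that column clashes with row 0. For `m = 1` the pair `(0, 0)` is not a root.
open scoped Classical in
theorem card_dAdd_addRow {n m : ℕ} (hm : 1 ≤ m) (hmn : m < n) {T : Finset (ℕ × ℕ)}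
    (hT : T ∈ stairIdeals (2 * n - 1) 1 (2 * n - m)) :
    (dAdd n (addRow (2 * n - 1) 0 m T)).card =
      (stairAdd (2 * n - 1) 1 (2 * n - m) T).card +
        if 2 ≤ m ∧ (1, 2 * n - m) ∉ T then 1 else 0 := by
  obtain ⟨h0, -, -⟩ := mem_stairIdeals.mp hT
  have key (a c : ℕ) : (a, c) ∈ dAdd n (addRow (2 * n - 1) 0 m T) ↔
      (a, c) ∈ stairAdd (2 * n - 1) 1 (2 * n - m) T ∨
      ((a, c) = (0, m - 1) ∧ 2 ≤ m ∧ (1, 2 * n - m) ∉ T) := by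
    rw [mem_dAdd, mem_stairAdd, mem_dRoots, Prod.mk.injEq]
    constructor
    · rintro ⟨h1, h2, h3, h4⟩
      rw [mem_addRow] at h2
      push Not at h2
      rcases Nat.eq_zero_or_pos a with rfl | ha
      · have hcm : c < m := by
          by_contra hcm
          have := h2.2 rfl (by omega)
          omega
        have hc : c = m - 1 := by
          rcases mem_addRow.mp (h3 (0, c + 1) (mem_dRoots.mpr (by omega))
            (Or.inr (Or.inl ⟨rfl, rfl, by simp only; omega⟩))) with h | h
          · have := h0 _ _ h
            omega
          · omega
        subst hc
        refine Or.inr ⟨⟨rfl, rfl⟩, by omega, fun h => ?_⟩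
        exact h4 _ (mem_addRow.mpr (Or.inl h)) (Or.inr (Or.inr ⟨by simp only; omega, by simp⟩))
      · have hc : 2 * n - m ≤ c := by
          by_contra hc
          refine h4 (0, 2 * n - 1 - c) (mem_addRow.mpr (Or.inr ⟨rfl, by omega, by omega⟩))
            (Or.inr (Or.inr ?_))
          simp only
          omega
        refine Or.inl ⟨by omega, h2.1, fun b hb hb' => ?_, fun h => ?_⟩
        · exact (mem_addRow.mp (h3 (b, c) (mem_dRoots.mpr (by omega))
            (Or.inl ⟨hb', rfl⟩))).resolve_right (by omega)
        · exact (mem_addRow.mp (h3 (a, c + 1) (mem_dRoots.mpr (by omega))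
            (Or.inr (Or.inl ⟨rfl, rfl, by simp only; omega⟩)))).resolve_right (by omega)
    · rintro (⟨h1, h2, h3, h4⟩ | ⟨⟨rfl, rfl⟩, h1, h2⟩)
      · refine ⟨by omega, fun h => ?_, ?_, ?_⟩
        · exact h2 ((mem_addRow.mp h).resolve_right (by omega))
        · rintro ⟨b, d⟩ hq hs
          rw [mem_dRoots] at hq
          simp only [DStep] at hs
          rcases Nat.eq_zero_or_pos b with rfl | hb
          · exact mem_addRow.mpr (Or.inr (by omega))
          · refine mem_addRow.mpr (Or.inl ?_)
            rcases hs with ⟨rfl, rfl⟩ | ⟨rfl, rfl, -⟩ | hs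
            · exact h3 _ hb rfl
            · exact h4 (by omega)
            · omega
        · rintro ⟨b, d⟩ hq hs
          simp only [DSum] at hs
          rcases mem_addRow.mp hq with h | h
          · have := h0 _ _ h
            omega
          · omega
      · refine ⟨by omega, fun h => ?_, ?_, ?_⟩
        · rcases mem_addRow.mp h with h | h
          · have := h0 _ _ h
            omega
          · omega
        · rintro ⟨b, d⟩ hq hs
          simp only [DStep] at hs
          exact mem_addRow.mpr (Or.inr (by omega))
        · rintro ⟨b, d⟩ hq hs
          simp only [DSum] at hs
          rcases mem_addRow.mp hq with h | h
          · have := h0 _ _ h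
            obtain rfl : d = 2 * n - m := by omega
            exact h2 (stairIdeals_closed hT h le_rfl (by omega) le_rfl (by omega))
          · omega
  split_ifs with hc
  · rw [← Finset.card_insert_of_notMem (a := (0, m - 1))]
    · congr 1
      ext ⟨a, c⟩
      rw [key, Finset.mem_insert]
      tauto
    · intro h3
      have := (mem_stairAdd.mp h3).1
      omega
  · rw [add_zero]
    congr 1
    ext ⟨a, c⟩
    rw [key]
    tauto

/-! ### The covering polynomials of the model -/

theorem sum_pow_card_dMin {n : ℕ} (hn : 3 ≤ n) :
    ∑ I ∈ dIdeals n, (X : ℤ[X]) ^ (dMin n I).card = evenPoly n + X * oddPoly (n - 1) +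
      X * oddPoly (n - 2) + X ^ 2 * evenPoly (n - 2) := by
  classical
  obtain ⟨r, rfl⟩ : ∃ r, n = r + 3 := ⟨n - 3, by omega⟩
  have e1 : ∑ T ∈ stairIdeals (2 * (r + 3) - 1) 0 (r + 3), (X : ℤ[X]) ^ (dMin (r + 3) T).card =
      evenPoly (r + 3) := by
    rw [Finset.sum_congr rfl fun T hT => by rw [dMin_of_mem_stairIdeals hT]]
    exact sum_pow_card_stairMin_total (by omega)
  have e2 : ∑ T ∈ (stairIdeals (2 * (r + 3) - 1) 0 (r + 3)).filter (fun T => (0, r + 3) ∈ T),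
      (X : ℤ[X]) ^ (dMin (r + 3) (twistSet (r + 3) T)).card = X * oddPoly (r + 2) := by
    rw [Finset.sum_congr rfl fun T hT => by
      rw [card_dMin_twistSet hn, dMin_of_mem_stairIdeals (Finset.mem_filter.mp hT).1]]
    exact (sum_pow_card_stairMin (r + 2) (by omega)).2
  have e3 (m : ℕ) (hm : m ∈ Finset.range (r + 2)) :
      ∑ T ∈ stairIdeals (2 * (r + 3) - 1) 1 (2 * (r + 3) - (1 + m)),
        (X : ℤ[X]) ^ (dMin (r + 3) (addRow (2 * (r + 3) - 1) 0 (1 + m) T)).card =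
      evenPoly m * X ^ (1 + if 1 + m + 1 = r + 3 then 1 else 0) := by
    rw [Finset.mem_range] at hm
    rw [Finset.sum_congr rfl fun T hT => by
      rw [card_dMin_addRow (by omega) (by omega) hT, add_assoc, pow_add], ← Finset.sum_mul,
      sum_pow_card_stairMin_total (N := m) (by omega)]
  have e4 (m : ℕ) (hm : m ∈ Finset.range (r + 1)) :
      evenPoly m * X ^ (1 + if 1 + m + 1 = r + 3 then 1 else 0) = X * evenPoly m := by
    rw [Finset.mem_range] at hm
    rw [if_neg (by omega), add_zero, pow_one, mul_comm]
  -- The last value `m = n - 1` is split off because it carries a second factor `X`; the others add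
  -- up by `sum_evenPoly`.
  rw [sum_dIdeals hn, e1, e2, Finset.sum_Ico_eq_sum_range, show r + 3 - 1 = r + 2 by omega,
    Finset.sum_congr rfl e3, Finset.sum_range_succ, if_pos (by omega), Finset.sum_congr rfl e4,
    ← Finset.mul_sum, sum_evenPoly, show r + 3 - 2 = r + 1 by omega]
  ring

theorem sum_pow_card_dAdd {n : ℕ} (hn : 3 ≤ n) :
    ∑ I ∈ dIdeals n, (X : ℤ[X]) ^ (dAdd n I).card = oddPoly n + X * evenPoly n := by
  classical
  obtain ⟨r, rfl⟩ : ∃ r, n = r + 3 := ⟨n - 3, by omega⟩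
  set L := 2 * (r + 3) - 1 with hL
  have sub (T) (hT : T ∈ stairIdeals L 0 (r + 3)) : T ⊆ dRoots (r + 3) := by
    rw [hL, ← filter_dIdeals_notMem hn, Finset.mem_filter] at hT
    exact (mem_dIdeals.mp hT.1).1
  -- For ideals without `(0, n)`, both `(0, n)` and `(0, n - 1)` are addable if `(0, n + 1)` is
  -- present, and neither is otherwise.
  have e0 : ∑ T ∈ stairIdeals L 0 (r + 3 + 1), (X : ℤ[X]) ^ (dAdd (r + 3) T).card =
      X * oddPoly (r + 1) + X ^ 2 * evenPoly (r + 1) := by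
    have h := sum_pow_card_stairAdd (L := L) r (lo := 0) (c₀ := r + 3 + 1) (by omega)
    rw [← h.1, ← h.2, Finset.mul_sum,
      ← Finset.sum_filter_not_add_sum_filter _ (fun T => (0, r + 3 + 1) ∈ T)]
    have hmem (T) (hT : T ∈ stairIdeals L 0 (r + 3 + 1)) :
        T ∈ stairIdeals L 0 (r + 3) ∧ (1, r + 3) ∉ T := by
      refine ⟨?_, fun h => ?_⟩
      · rw [← filter_corner_notMem] at hT
        exact (Finset.mem_filter.mp hT).1
      · have := (mem_stairIdeals.mp hT).1 _ _ h
        omega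
    refine congrArg₂ (· + ·) ?_ ?_ <;> refine Finset.sum_congr rfl fun T hT => ?_ <;>
      rw [Finset.mem_filter] at hT <;> have hT' := hmem T hT.1
    · rw [card_dAdd_of_mem_stairIdeals hn hT'.1, if_neg fun h => hT.2 h.1,
        card_stairAdd_of_corner_notMem (by omega) hT.1, if_pos ⟨by omega, hT.2⟩]
      rfl
    · rw [card_dAdd_of_mem_stairIdeals hn hT'.1, if_pos ⟨hT.2, hT'.2⟩,
        card_stairAdd_of_corner_notMem (by omega) hT.1, if_neg fun h => h.2 hT.2]
      ring
  -- Here the full row 0 supplies `(0, n + 1)`, so `(0, n - 1)` is addable exactly when `(1, n)` is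
  -- absent.
  have e1 : ∑ T ∈ (stairIdeals L 0 (r + 3)).filter (fun T => (0, r + 3) ∈ T),
      (X : ℤ[X]) ^ (dAdd (r + 3) T).card =
      evenPoly (r + 1) + X ^ 2 * oddPoly (r + 1) := by
    have h := sum_pow_card_stairAdd (L := L) r (lo := 1) (c₀ := r + 3) (by omega)
    rw [sum_filter_corner_mem (by omega), pow_two, mul_assoc, ← h.1, ← h.2, Finset.mul_sum,
      ← Finset.sum_filter_not_add_sum_filter _ (fun T => (1, r + 3) ∈ T), add_comm]
    refine congrArg₂ (· + ·) ?_ ?_ <;> refine Finset.sum_congr rfl fun T hT => ?_ <;>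
      rw [Finset.mem_filter] at hT <;> have hT' := addRow_mem_stairIdeals hT.1
    · rw [card_dAdd_of_mem_stairIdeals hn hT', if_neg, stairAdd_addRow hT.1, add_zero]
      exact fun h => h.2 (mem_addRow.mpr (Or.inl hT.2))
    · rw [card_dAdd_of_mem_stairIdeals hn hT', if_pos, stairAdd_addRow hT.1]
      · ring
      · refine ⟨mem_addRow.mpr (Or.inr (by omega)), fun h => ?_⟩
        exact hT.2 ((mem_addRow.mp h).resolve_right (by omega))
  have e2 : ∑ T ∈ (stairIdeals L 0 (r + 3)).filter (fun T => (0, r + 3) ∈ T),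
      (X : ℤ[X]) ^ (dAdd (r + 3) (twistSet (r + 3) T)).card =
      evenPoly (r + 1) + X ^ 2 * oddPoly (r + 1) := by
    rw [← e1]
    exact Finset.sum_congr rfl fun T hT => by
      rw [card_dAdd_twistSet hn (sub T (Finset.mem_filter.mp hT).1)]
  have e3 (m : ℕ) (hm : m ∈ Finset.range r) :
      ∑ T ∈ stairIdeals L 1 (2 * (r + 3) - (1 + (m + 1 + 1))),
        (X : ℤ[X]) ^ (dAdd (r + 3) (addRow L 0 (1 + (m + 1 + 1)) T)).card =
      evenPoly (m + 1) + X * (X * oddPoly (m + 1)) := by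
    rw [Finset.mem_range] at hm
    have h := sum_pow_card_stairAdd (L := L) m (lo := 1)
      (c₀ := 2 * (r + 3) - (1 + (m + 1 + 1))) (by omega)
    rw [← h.1, ← h.2, Finset.mul_sum, ← Finset.sum_filter_not_add_sum_filter _
      (fun T => (1, 2 * (r + 3) - (1 + (m + 1 + 1))) ∈ T), add_comm]
    refine congrArg₂ (· + ·) ?_ ?_ <;> refine Finset.sum_congr rfl fun T hT => ?_ <;>
      rw [Finset.mem_filter] at hT
    · rw [card_dAdd_addRow (by omega) (by omega) hT.1, if_neg fun h => h.2 hT.2, add_zero]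
    · rw [card_dAdd_addRow (by omega) (by omega) hT.1, if_pos ⟨by omega, hT.2⟩]
      ring
  have empty (c : ℕ) (hc : L ≤ 1 + c) : stairAdd L 1 c ∅ = ∅ := by
    refine Finset.eq_empty_of_forall_notMem fun p hp => ?_
    have := (mem_stairAdd (a := p.1) (c := p.2).mp hp).1
    omega
  -- For `m = 1` and `m = 2` the remaining staircase is empty, a case outside
  -- `sum_pow_card_stairAdd`; these two terms are computed by hand.
  have e4 : ∑ T ∈ stairIdeals L 1 (2 * (r + 3) - (1 + 0)),
      (X : ℤ[X]) ^ (dAdd (r + 3) (addRow L 0 (1 + 0) T)).card = 1 := by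
    rw [Finset.sum_congr rfl fun T hT => by rw [card_dAdd_addRow (by omega) (by omega) hT],
      stairIdeals_of_le (by omega), Finset.sum_singleton, ← hL, empty _ (by omega)]
    simp
  have e5 : ∑ T ∈ stairIdeals L 1 (2 * (r + 3) - (1 + (0 + 1))),
      (X : ℤ[X]) ^ (dAdd (r + 3) (addRow L 0 (1 + (0 + 1)) T)).card = X := by
    rw [Finset.sum_congr rfl fun T hT => by rw [card_dAdd_addRow (by omega) (by omega) hT],
      stairIdeals_of_le (by omega), Finset.sum_singleton, ← hL, empty _ (by omega)]
    simp
  have s1 := sum_evenPoly (r + 1)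
  have s2 := sum_X_mul_oddPoly (r + 1)
  rw [Finset.sum_range_succ'] at s1 s2
  rw [sum_dIdeals hn, ← Finset.sum_filter_not_add_sum_filter (stairIdeals L 0 (r + 3))
    (fun T => (0, r + 3) ∈ T), filter_corner_notMem, e0, e1, e2, Finset.sum_Ico_eq_sum_range,
    show r + 3 - 1 = r + 1 + 1 by omega, Finset.sum_range_succ', Finset.sum_range_succ', e4, e5,
    Finset.sum_congr rfl e3, Finset.sum_add_distrib, ← Finset.mul_sum]
  simp only [evenPoly_zero, oddPoly_zero] at s1 s2
  rw [show oddPoly (r + 3) = oddPoly (r + 1) + evenPoly (r + 1) + (evenPoly (r + 1) +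
      X * oddPoly (r + 1)) by rw [oddPoly_succ, oddPoly_succ (r + 1), evenPoly_succ (r + 1)],
    show evenPoly (r + 3) = evenPoly (r + 1) + X * oddPoly (r + 1) + X * (oddPoly (r + 1) +
      evenPoly (r + 1)) by rw [evenPoly_succ, oddPoly_succ (r + 1), evenPoly_succ (r + 1)]]
  linear_combination s1 + X * s2

end TypeD

/-! ### Covering polynomials and order isomorphisms -/

section OrderIso

variable {α β : Type*} [PartialOrder α] [PartialOrder β]

theorem numCoveredBy_apply (e : α ≃o β) (x : α) : numCoveredBy (e x) = numCoveredBy x :=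
  (Nat.card_congr (e.toEquiv.subtypeEquiv (p := (· ⋖ x)) (q := (· ⋖ e x))
    fun _ => (apply_covBy_apply_iff e).symm)).symm

theorem numCovering_apply (e : α ≃o β) (x : α) : numCovering (e x) = numCovering x :=
  (Nat.card_congr (e.toEquiv.subtypeEquiv fun _ => (apply_covBy_apply_iff e).symm)).symm

theorem upperCoveringPoly_congr [Finite α] [Finite β] (e : α ≃o β) :
    upperCoveringPoly α = upperCoveringPoly β :=
  finsum_eq_of_bijective e e.bijective fun x => by rw [numCoveredBy_apply]

theorem lowerCoveringPoly_congr [Finite α] [Finite β] (e : α ≃o β) :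
    lowerCoveringPoly α = lowerCoveringPoly β :=
  finsum_eq_of_bijective e e.bijective fun x => by rw [numCovering_apply]

end OrderIso

namespace TypeD

/-! ### Covering relations between abelian ideals of the model -/

theorem DStep.sub_lt {n : ℕ} {p q : ℕ × ℕ} (h : DStep n p q) :
    (p.2 : ℤ) - p.1 < (q.2 : ℤ) - q.1 := by
  simp only [DStep] at h
  omega

theorem DSum.symm {n : ℕ} {p q : ℕ × ℕ} (h : DSum n p q) : DSum n q p := by
  simp only [DSum] at *
  omega

theorem not_DSum_self {n : ℕ} {p : ℕ × ℕ} (hp : p ∈ dRoots n) : ¬ DSum n p p := by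
  have := mem_dRoots (a := p.1) (c := p.2).mp hp
  simp only [DSum]
  omega

open scoped Classical in
theorem erase_mem_dIdeals {n : ℕ} {I : Finset (ℕ × ℕ)} (hI : I ∈ dIdeals n) {p : ℕ × ℕ}
    (hp : p ∈ dMin n I) : I.erase p ∈ dIdeals n := by
  obtain ⟨h0, h1, h2⟩ := mem_dIdeals.mp hI
  refine mem_dIdeals.mpr ⟨(Finset.erase_subset _ _).trans h0, fun q hq q' hq' hs => ?_,
    fun q hq q' hq' => h2 q (Finset.mem_of_mem_erase hq) q' (Finset.mem_of_mem_erase hq')⟩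
  have hqI := Finset.mem_of_mem_erase hq
  refine Finset.mem_erase.mpr ⟨?_, h1 q hqI q' hq' hs⟩
  rintro rfl
  exact (mem_dMin.mp hp).2 q hqI hs

open scoped Classical in
theorem insert_mem_dIdeals {n : ℕ} {I : Finset (ℕ × ℕ)} (hI : I ∈ dIdeals n) {p : ℕ × ℕ}
    (hp : p ∈ dAdd n I) : insert p I ∈ dIdeals n := by
  obtain ⟨h0, h1, h2⟩ := mem_dIdeals.mp hI
  obtain ⟨h3, h4, h5, h6⟩ := mem_dAdd.mp hp
  refine mem_dIdeals.mpr ⟨Finset.insert_subset h3 h0, fun q hq q' hq' hs => ?_,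
    fun q hq q' hq' hs => ?_⟩
  · rcases Finset.mem_insert.mp hq with rfl | hq
    · exact Finset.mem_insert_of_mem (h5 q' hq' hs)
    · exact Finset.mem_insert_of_mem (h1 q hq q' hq' hs)
  · rcases Finset.mem_insert.mp hq with rfl | hqI <;>
      rcases Finset.mem_insert.mp hq' with rfl | hqI'
    · exact not_DSum_self h3 hs
    · exact h6 _ hqI' hs
    · exact h6 _ hqI hs.symm
    · exact h2 _ hqI _ hqI' hs

/-- Steps increase `c - a`. A root of `J \ I` with the largest `c - a` therefore has all its upper
neighbours in `I`. -/
theorem exists_mem_dAdd {n : ℕ} {I J : Finset (ℕ × ℕ)} (hJ : J ∈ dIdeals n) (h : I ⊂ J) :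
    ∃ p ∈ dAdd n I, p ∈ J := by
  classical
  obtain ⟨h0, h1, h2⟩ := mem_dIdeals.mp hJ
  obtain ⟨p, hp, hmax⟩ := Finset.exists_max_image (J \ I) (fun p => (p.2 : ℤ) - p.1)
    (Finset.sdiff_nonempty.mpr h.2)
  rw [Finset.mem_sdiff] at hp
  refine ⟨p, mem_dAdd.mpr ⟨h0 hp.1, hp.2, fun q hq hs => ?_, fun q hq => h2 p hp.1 q (h.1 hq)⟩,
    hp.1⟩
  by_contra hqI
  exact (hmax q (Finset.mem_sdiff.mpr ⟨h1 p hp.1 q hq hs, hqI⟩)).not_gt hs.sub_lt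

open scoped Classical in
theorem covBy_iff_insert {n : ℕ} {I J : {I // I ∈ dIdeals n}} :
    I ⋖ J ↔ ∃ p ∈ dAdd n I.1, insert p I.1 = J.1 := by
  constructor
  · intro h
    obtain ⟨p, hp, hpJ⟩ := exists_mem_dAdd J.2 h.1
    refine ⟨p, hp, ?_⟩
    have hle : (⟨insert p I.1, insert_mem_dIdeals I.2 hp⟩ : {I // I ∈ dIdeals n}) ≤ J :=
      Finset.insert_subset hpJ h.1.le
    have hlt : I < (⟨insert p I.1, insert_mem_dIdeals I.2 hp⟩ : {I // I ∈ dIdeals n}) :=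
      Finset.ssubset_insert (mem_dAdd.mp hp).2.1
    exact congrArg Subtype.val (hle.eq_of_not_lt (h.2 hlt))
  · rintro ⟨p, hp, h⟩
    refine CovBy.of_image (OrderEmbedding.subtype _) ?_
    change I.1 ⋖ J.1
    rw [← h]
    exact Finset.covBy_insert (mem_dAdd.mp hp).2.1

open scoped Classical in
theorem covBy_iff_erase {n : ℕ} {I J : {I // I ∈ dIdeals n}} :
    I ⋖ J ↔ ∃ p ∈ dMin n J.1, J.1.erase p = I.1 := by
  rw [covBy_iff_insert]
  constructor
  · rintro ⟨p, hp, h⟩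
    refine ⟨p, mem_dMin.mpr ⟨h ▸ Finset.mem_insert_self _ _, fun q hq hs => ?_⟩, ?_⟩
    · rw [← h] at hq
      rcases Finset.mem_insert.mp hq with rfl | hq
      · exact lt_irrefl _ hs.sub_lt
      · exact (mem_dAdd.mp hp).2.1 ((mem_dIdeals.mp I.2).2.1 q hq p (mem_dAdd.mp hp).1 hs)
    · rw [← h, Finset.erase_insert (mem_dAdd.mp hp).2.1]
  · rintro ⟨p, hp, h⟩
    have hpJ := (mem_dMin.mp hp).1
    obtain ⟨h0, h1, h2⟩ := mem_dIdeals.mp J.2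
    refine ⟨p, mem_dAdd.mpr ⟨h0 hpJ, ?_, fun q hq hs => ?_, fun q hq => ?_⟩, ?_⟩
    · rw [← h]
      exact Finset.notMem_erase p _
    · rw [← h]
      refine Finset.mem_erase.mpr ⟨?_, h1 p hpJ q hq hs⟩
      rintro rfl
      exact lt_irrefl _ hs.sub_lt
    · rw [← h] at hq
      exact h2 p hpJ q (Finset.mem_of_mem_erase hq)
    · rw [← h, Finset.insert_erase hpJ]

theorem numCoveredBy_eq_card_dMin {n : ℕ} (J : {I // I ∈ dIdeals n}) :
    numCoveredBy J = (dMin n J.1).card := by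
  classical
  rw [← Fintype.card_coe, ← Nat.card_eq_fintype_card]
  refine (Nat.card_eq_of_bijective (fun p : dMin n J.1 =>
    (⟨⟨J.1.erase p.1, erase_mem_dIdeals J.2 p.2⟩, covBy_iff_erase.mpr ⟨p.1, p.2, rfl⟩⟩ :
      {I : {I // I ∈ dIdeals n} // I ⋖ J})) ⟨fun p q h => ?_, fun I => ?_⟩).symm
  · have h' : J.1.erase p.1 = J.1.erase q.1 := congrArg (fun I => I.1.1) h
    exact Subtype.ext ((Finset.erase_inj _ (mem_dMin.mp p.2).1).mp h')
  · obtain ⟨p, hp, h⟩ := covBy_iff_erase.mp I.2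
    exact ⟨⟨p, hp⟩, Subtype.ext (Subtype.ext h)⟩

theorem numCovering_eq_card_dAdd {n : ℕ} (I : {I // I ∈ dIdeals n}) :
    numCovering I = (dAdd n I.1).card := by
  classical
  rw [← Fintype.card_coe, ← Nat.card_eq_fintype_card]
  refine (Nat.card_eq_of_bijective (fun p : dAdd n I.1 =>
    (⟨⟨insert p.1 I.1, insert_mem_dIdeals I.2 p.2⟩, covBy_iff_insert.mpr ⟨p.1, p.2, rfl⟩⟩ :
      {J : {I // I ∈ dIdeals n} // I ⋖ J})) ⟨fun p q h => ?_, fun J => ?_⟩).symm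
  · have h' : insert p.1 I.1 = insert q.1 I.1 := congrArg (fun I => I.1.1) h
    exact Subtype.ext ((Finset.insert_inj (mem_dAdd.mp p.2).2.1).mp h')
  · obtain ⟨p, hp, h⟩ := covBy_iff_insert.mp J.2
    exact ⟨⟨p, hp⟩, Subtype.ext (Subtype.ext h)⟩

theorem upperCoveringPoly_dIdeals {n : ℕ} (hn : 3 ≤ n) :
    upperCoveringPoly {I // I ∈ dIdeals n} = evenPoly n + X * oddPoly (n - 1) +
      X * oddPoly (n - 2) + X ^ 2 * evenPoly (n - 2) := by
  rw [← sum_pow_card_dMin hn, upperCoveringPoly, finsum_eq_sum_of_fintype]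
  simp only [numCoveredBy_eq_card_dMin]
  exact Finset.sum_coe_sort (dIdeals n) fun I => (X : ℤ[X]) ^ (dMin n I).card

theorem lowerCoveringPoly_dIdeals {n : ℕ} (hn : 3 ≤ n) :
    lowerCoveringPoly {I // I ∈ dIdeals n} = oddPoly n + X * evenPoly n := by
  rw [← sum_pow_card_dAdd hn, lowerCoveringPoly, finsum_eq_sum_of_fintype]
  simp only [numCovering_eq_card_dAdd]
  exact Finset.sum_coe_sort (dIdeals n) fun I => (X : ℤ[X]) ^ (dAdd n I).card

/-! ### Abelian ideals of a root system and of the model -/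

section Transfer

variable {ι R M N : Type*} [CommRing R] [CharZero R] [AddCommGroup M] [Module R M]
  [AddCommGroup N] [Module R N] {P : RootPairing ι R M N} {b : P.Base}

theorem vec_injective : Function.Injective (PosRoot.vec : PosRoot b → M) :=
  fun _ _ h => Subtype.ext (P.root.injective h)

/-- A labelling of the positive roots by the roots of the model that is compatible with the
covering relation and with sums. -/
structure RootLabelling (b : P.Base) (n : ℕ) where
  /-- The label of a positive root. -/
  label : PosRoot b → ℕ × ℕ
  injective : Function.Injective label
  mem_dRoots (γ : PosRoot b) : label γ ∈ dRoots n
  surjective (p : ℕ × ℕ) (hp : p ∈ dRoots n) : ∃ γ, label γ = p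
  step_iff (μ γ : PosRoot b) : PosRoot.Step μ γ ↔ DStep n (label μ) (label γ)
  sum_iff (γ γ' : PosRoot b) :
    (∃ δ : PosRoot b, δ.vec = γ.vec + γ'.vec) ↔ DSum n (label γ) (label γ')

theorem isUpperSet_iff_step {I : Set (PosRoot b)} :
    IsUpperSet I ↔ ∀ μ γ, PosRoot.Step μ γ → μ ∈ I → γ ∈ I := by
  constructor
  · exact fun h μ γ hs hμ => h (Relation.ReflTransGen.single hs) hμ
  · intro h μ γ hle hμ
    induction hle with
    | refl => exact hμ
    | tail _ hs ih => exact h _ _ hs ih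

open scoped Classical in
/-- The abelian ideals of the root system and those of the model are the same poset. -/
def RootLabelling.orderIso {n : ℕ} (l : RootLabelling b n) :
    AbelianIdeals b ≃o {I // I ∈ dIdeals n} where
  toFun I := ⟨(dRoots n).filter fun p => ∃ γ ∈ I.1, l.label γ = p, by
    have hup := isUpperSet_iff_step.mp I.2.1
    refine mem_dIdeals.mpr ⟨Finset.filter_subset _ _, fun p hp q hq hs => ?_,
      fun p hp q hq hs => ?_⟩
    · obtain ⟨μ, hμ, rfl⟩ := (Finset.mem_filter.mp hp).2
      obtain ⟨γ, rfl⟩ := l.surjective q hq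
      exact Finset.mem_filter.mpr ⟨hq, γ, hup μ γ ((l.step_iff μ γ).mpr hs) hμ, rfl⟩
    · obtain ⟨γ, hγ, rfl⟩ := (Finset.mem_filter.mp hp).2
      obtain ⟨γ', hγ', rfl⟩ := (Finset.mem_filter.mp hq).2
      exact I.2.2 γ hγ γ' hγ' ((l.sum_iff γ γ').mpr hs)⟩
  invFun J := ⟨{γ | l.label γ ∈ J.1}, by
    obtain ⟨h0, h1, h2⟩ := mem_dIdeals.mp J.2
    refine ⟨isUpperSet_iff_step.mpr fun μ γ hs hμ => ?_, fun γ hγ γ' hγ' hs => ?_⟩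
    · exact h1 _ hμ _ (l.mem_dRoots γ) ((l.step_iff μ γ).mp hs)
    · exact h2 _ hγ _ hγ' ((l.sum_iff γ γ').mp hs)⟩
  left_inv I := by
    refine Subtype.ext (Set.ext fun γ => ?_)
    simp only [Set.mem_ofPred_eq, Finset.mem_filter, l.mem_dRoots, true_and]
    exact ⟨fun ⟨γ', h, h'⟩ => l.injective h' ▸ h, fun h => ⟨γ, h, rfl⟩⟩
  right_inv J := by
    refine Subtype.ext (Finset.ext fun p => ?_)
    simp only [Set.mem_ofPred_eq, Finset.mem_filter]
    constructor
    · rintro ⟨-, γ, h, rfl⟩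
      exact h
    · intro h
      have hp := (mem_dIdeals.mp J.2).1 h
      obtain ⟨γ, rfl⟩ := l.surjective p hp
      exact ⟨hp, γ, h, rfl⟩
  map_rel_iff' {I J} := by
    constructor
    · intro h γ hγ
      have h' := h (Finset.mem_filter.mpr ⟨l.mem_dRoots γ, γ, hγ, rfl⟩)
      obtain ⟨γ', hγ', e⟩ := (Finset.mem_filter.mp h').2
      exact l.injective e ▸ hγ'
    · intro h p hp
      obtain ⟨h1, γ, hγ, e⟩ := Finset.mem_filter.mp hp
      exact Finset.mem_filter.mpr ⟨h1, γ, h hγ, e⟩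

end Transfer

/-! ### The standard realization of the root system -/

section Standard

variable (R : Type*) [Field R]

/-- The weights of the vector representation of `so_{2n}`: `ε₀, …, ε_{n-1}, -ε_{n-1}, …, -ε₀`. -/
def eps (n c : ℕ) : ℕ → R := if c < n then Pi.single c 1 else -Pi.single (2 * n - 1 - c) 1

/-- The standard symmetric bilinear form on the first `n` coordinates. -/
def stdForm (n : ℕ) : (ℕ → R) →ₗ[R] (ℕ → R) →ₗ[R] R :=
  LinearMap.mk₂ R (fun v w => ∑ i ∈ Finset.range n, v i * w i)
    (fun _ _ _ => by simp [add_mul, Finset.sum_add_distrib])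
    (fun _ _ _ => by simp [mul_assoc, Finset.mul_sum])
    (fun _ _ _ => by simp [mul_add, Finset.sum_add_distrib])
    (fun _ _ _ => by simp [mul_left_comm, Finset.mul_sum])

/-- The linear functional that takes the value `1` on every simple root. -/
def heightForm (n : ℕ) : (ℕ → R) →ₗ[R] R :=
  ∑ i ∈ Finset.range n, ((n : R) - 1 - i) • LinearMap.proj i

variable {R}

theorem eps_eq_neg {n a c : ℕ} (h : a + c + 1 = 2 * n) : eps R n a = -eps R n c := by
  unfold eps
  split_ifs with h1 h2 h2
  · omega
  · rw [neg_neg, show 2 * n - 1 - c = a by omega]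
  · rw [show 2 * n - 1 - a = c by omega]
  · omega

theorem stdForm_eps {n a c : ℕ} (ha : a < 2 * n) (hc : c < 2 * n) :
    stdForm R n (eps R n a) (eps R n c) =
      (if a = c then 1 else 0) - if a + c + 1 = 2 * n then 1 else 0 := by
  have key {a c : ℕ} (ha : a < n) (hc : c < n) :
      stdForm R n (eps R n a) (eps R n c) = if a = c then 1 else 0 := by
    simp only [stdForm, LinearMap.mk₂_apply, eps, ha, hc, if_true, Pi.single_apply]
    simp only [mul_ite, mul_one, mul_zero, Finset.sum_ite_eq', Finset.mem_range, hc, if_true]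
    simp only [eq_comm]
  rcases lt_or_ge a n with ha' | ha' <;> rcases lt_or_ge c n with hc' | hc'
  · rw [key ha' hc', if_neg (c := a + c + 1 = 2 * n) (by omega), sub_zero]
  · rw [eps_eq_neg (a := c) (c := 2 * n - 1 - c) (by omega), map_neg, key ha' (by omega),
      if_neg (c := a = c) (by omega), zero_sub]
    congr 2
    simp only [eq_iff_iff]
    omega
  · rw [eps_eq_neg (a := a) (c := 2 * n - 1 - a) (by omega), map_neg, LinearMap.neg_apply,
      key (by omega) hc', if_neg (c := a = c) (by omega), zero_sub]
    congr 2
    simp only [eq_iff_iff]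
    omega
  · rw [eps_eq_neg (a := a) (c := 2 * n - 1 - a) (by omega),
      eps_eq_neg (a := c) (c := 2 * n - 1 - c) (by omega), map_neg, map_neg, LinearMap.neg_apply,
      neg_neg, key (by omega) (by omega), if_neg (c := a + c + 1 = 2 * n) (by omega), sub_zero]
    congr 1
    simp only [eq_iff_iff]
    omega

theorem heightForm_eps {n c : ℕ} (hc : c < 2 * n) :
    heightForm R n (eps R n c) = ((if c < n then (n : ℤ) - 1 - c else n - c : ℤ) : R) := by
  have key {c : ℕ} (hc : c < n) : heightForm R n (eps R n c) = (n : R) - 1 - c := by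
    simp only [heightForm, eps, hc, if_true, LinearMap.sum_apply, LinearMap.smul_apply,
      LinearMap.proj_apply, Pi.single_apply, smul_eq_mul, mul_ite, mul_one, mul_zero,
      Finset.sum_ite_eq', Finset.mem_range]
  split_ifs with h
  · rw [key h]
    push_cast
    ring
  · rw [eps_eq_neg (a := c) (c := 2 * n - 1 - c) (by omega), map_neg, key (by omega),
      Nat.cast_sub (by omega), Nat.cast_sub (by omega)]
    push_cast
    ring

/-- The vector of a root of the model. -/
def rootVec (R : Type*) [Field R] (n : ℕ) (p : ℕ × ℕ) : ℕ → R :=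
  eps R n p.1 - eps R n p.2

/-- The inner product of two positive roots. -/
theorem stdForm_rootVec {n : ℕ} {p q : ℕ × ℕ} (hp : p ∈ dRoots n) (hq : q ∈ dRoots n) :
    stdForm R n (rootVec R n p) (rootVec R n q) =
      (((if p.1 = q.1 then 1 else 0) + (if p.2 = q.2 then 1 else 0)
        + (if p.1 + q.2 + 1 = 2 * n then 1 else 0) + (if p.2 + q.1 + 1 = 2 * n then 1 else 0)
        - (if p.1 = q.2 then 1 else 0) - (if p.2 = q.1 then 1 else 0)
        - (if p.2 + q.2 + 1 = 2 * n then 1 else 0) : ℤ) : R) := by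
  obtain ⟨a, c⟩ := p
  obtain ⟨b, d⟩ := q
  rw [mem_dRoots] at hp hq
  simp only [rootVec, map_sub, LinearMap.sub_apply]
  rw [stdForm_eps (by omega) (by omega), stdForm_eps (by omega) (by omega),
    stdForm_eps (by omega) (by omega), stdForm_eps (by omega) (by omega),
    if_neg (c := a + b + 1 = 2 * n) (by omega)]
  push_cast
  ring

theorem stdForm_rootVec_self {n : ℕ} {p : ℕ × ℕ} (hp : p ∈ dRoots n) :
    stdForm R n (rootVec R n p) (rootVec R n p) = 2 := by
  rw [stdForm_rootVec hp hp]
  obtain ⟨a, c⟩ := p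
  rw [mem_dRoots] at hp
  dsimp only
  rw [if_pos rfl, if_pos rfl, if_neg (by omega), if_neg (by omega), if_neg (by omega),
    if_neg (by omega), if_neg (by omega)]
  norm_num

theorem stdForm_comm (n : ℕ) (v w : ℕ → R) : stdForm R n v w = stdForm R n w v := by
  simp [stdForm, mul_comm]

/-- Equal vectors have inner product 2, and the table of inner products reaches 2 only on the
diagonal. -/
theorem rootVec_injOn [CharZero R] {n : ℕ} {p q : ℕ × ℕ} (hp : p ∈ dRoots n) (hq : q ∈ dRoots n)
    (h : rootVec R n p = rootVec R n q) : p = q := by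
  have h1 := stdForm_rootVec_self (R := R) hp
  nth_rw 2 [h] at h1
  rw [stdForm_rootVec hp hq, show (2 : R) = ((2 : ℤ) : R) by norm_num, Int.cast_inj] at h1
  obtain ⟨a, c⟩ := p
  obtain ⟨b, d⟩ := q
  rw [mem_dRoots] at hp hq
  rw [Prod.mk.injEq]
  split_ifs at h1 <;> omega

/-- All three vectors have norm 2, which forces the inner product of the summands to be -1; the
table then leaves only the listed cases. -/
theorem DSum_of_rootVec_add [CharZero R] {n : ℕ} {p q r : ℕ × ℕ} (hp : p ∈ dRoots n)
    (hq : q ∈ dRoots n) (hr : r ∈ dRoots n)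
    (h : rootVec R n r = rootVec R n p + rootVec R n q) : DSum n p q := by
  have h1 := stdForm_rootVec_self (R := R) hr
  rw [h, map_add, map_add, LinearMap.add_apply, LinearMap.add_apply, stdForm_rootVec_self hp,
    stdForm_rootVec_self hq, stdForm_comm n (rootVec R n q)] at h1
  have h2 : stdForm R n (rootVec R n p) (rootVec R n q) = ((-1 : ℤ) : R) := by
    push_cast
    linear_combination h1 / 2
  rw [stdForm_rootVec hp hq, Int.cast_inj] at h2
  obtain ⟨a, c⟩ := p
  obtain ⟨b, d⟩ := q
  rw [mem_dRoots] at hp hq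
  simp only [DSum]
  split_ifs at h2 <;> omega

theorem exists_rootVec_eq_add {n : ℕ} {p q : ℕ × ℕ} (hp : p ∈ dRoots n) (hq : q ∈ dRoots n)
    (h : DSum n p q) : ∃ r ∈ dRoots n, rootVec R n r = rootVec R n p + rootVec R n q := by
  obtain ⟨a, c⟩ := p
  obtain ⟨b, d⟩ := q
  rw [mem_dRoots] at hp hq
  simp only [DSum] at h
  simp only [rootVec]
  rcases h with ⟨rfl, h⟩ | ⟨rfl, h⟩ | ⟨h, h'⟩
  · rcases lt_or_gt_of_ne h with h | h
    · exact ⟨(a, d), mem_dRoots.mpr (by omega), by simp⟩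
    -- The pairs `(a, d)` and `(2n - 1 - d, 2n - 1 - a)` name the same vector; the model keeps the
    -- one with the smaller index sum.
    · refine ⟨(2 * n - 1 - d, 2 * n - 1 - a), mem_dRoots.mpr (by omega), ?_⟩
      simp only
      rw [eps_eq_neg (show 2 * n - 1 - d + d + 1 = 2 * n by omega),
        eps_eq_neg (show 2 * n - 1 - a + a + 1 = 2 * n by omega)]
      abel
  · rcases lt_or_gt_of_ne h with h | h
    · exact ⟨(b, c), mem_dRoots.mpr (by omega), by simp⟩
    · refine ⟨(2 * n - 1 - c, 2 * n - 1 - b), mem_dRoots.mpr (by omega), ?_⟩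
      simp only
      rw [eps_eq_neg (show 2 * n - 1 - c + c + 1 = 2 * n by omega),
        eps_eq_neg (show 2 * n - 1 - b + b + 1 = 2 * n by omega)]
      abel
  · rcases lt_or_gt_of_ne h' with h' | h'
    · refine ⟨(a, 2 * n - 1 - b), mem_dRoots.mpr (by omega), ?_⟩
      simp only
      rw [eps_eq_neg (show 2 * n - 1 - b + b + 1 = 2 * n by omega), eps_eq_neg h]
      abel
    · refine ⟨(b, 2 * n - 1 - a), mem_dRoots.mpr (by omega), ?_⟩
      simp only
      rw [eps_eq_neg (show 2 * n - 1 - a + a + 1 = 2 * n by omega), eps_eq_neg h]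
      abel

/-! ### Simple roots and their reflections -/

/-- The labels of the simple roots. -/
def simpleLabel (n k : ℕ) : ℕ × ℕ := if k + 1 < n then (k, k + 1) else (n - 2, n)

theorem simpleLabel_mem {n k : ℕ} (hn : 3 ≤ n) : simpleLabel n k ∈ dRoots n := by
  unfold simpleLabel
  split_ifs <;> rw [mem_dRoots] <;> omega

/-- `DSum_of_rootVec_add` lists how `p` can meet a simple root. Each possible case exhibits a root
one step above `p` with the right vector, and `rootVec_injOn` identifies it with `q`. -/
theorem DStep_of_rootVec_sub [CharZero R] {n : ℕ} (hn : 3 ≤ n) {p q : ℕ × ℕ} {k : ℕ}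
    (hp : p ∈ dRoots n) (hq : q ∈ dRoots n)
    (h : rootVec R n q - rootVec R n p = rootVec R n (simpleLabel n k)) :
    DStep n p q := by
  have h' : rootVec R n q = rootVec R n p + rootVec R n (simpleLabel n k) := by rw [← h]; abel
  have hs := DSum_of_rootVec_add hp (simpleLabel_mem hn) hq h'
  have fin (r : ℕ × ℕ) (hr : r ∈ dRoots n)
      (e : rootVec R n r = rootVec R n p + rootVec R n (simpleLabel n k)) (hst : DStep n p r) :
      DStep n p q := rootVec_injOn hr hq (e.trans h'.symm) ▸ hst
  obtain ⟨a, c⟩ := p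
  rw [mem_dRoots] at hp
  simp only [rootVec] at fin
  by_cases hk : k + 1 < n
  · simp only [simpleLabel, if_pos hk, DSum] at hs fin
    rcases hs with ⟨rfl, h1⟩ | ⟨rfl, h1⟩ | ⟨h1, h2⟩
    · exact fin (a, c + 1) (mem_dRoots.mpr (by omega)) (by simp)
        (Or.inr (Or.inl ⟨rfl, rfl, by simp only; omega⟩))
    · exact fin (k, c) (mem_dRoots.mpr (by omega)) (by simp) (Or.inl ⟨rfl, rfl⟩)
    · refine fin (a, c + 1) (mem_dRoots.mpr (by omega)) ?_
        (Or.inr (Or.inl ⟨rfl, rfl, by simp only; omega⟩))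
      simp only
      rw [eps_eq_neg (show c + 1 + k + 1 = 2 * n by omega), eps_eq_neg h1]
      abel
  · simp only [simpleLabel, if_neg hk, DSum] at hs fin
    rcases hs with ⟨rfl, h1⟩ | ⟨rfl, h1⟩ | ⟨h1, h2⟩
    · exact fin (a, n) (mem_dRoots.mpr (by omega)) (by simp)
        (Or.inr (Or.inr ⟨rfl, by simp only; omega, by simp only; omega⟩))
    · omega
    · refine fin (a, c + 2) (mem_dRoots.mpr (by omega)) ?_
        (Or.inr (Or.inr ⟨rfl, rfl, by simp only; omega⟩))
      simp only
      rw [eps_eq_neg (show c + 2 + (n - 2) + 1 = 2 * n by omega), eps_eq_neg h1]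
      abel

theorem exists_rootVec_sub_eq {n : ℕ} (hn : 3 ≤ n) {p q : ℕ × ℕ} (hp : p ∈ dRoots n)
    (hq : q ∈ dRoots n) (h : DStep n p q) :
    ∃ k < n, rootVec R n q - rootVec R n p = rootVec R n (simpleLabel n k) := by
  obtain ⟨a, c⟩ := p
  obtain ⟨b, d⟩ := q
  rw [mem_dRoots] at hp hq
  simp only [DStep] at h
  rcases h with ⟨rfl, rfl⟩ | ⟨rfl, rfl, h⟩ | ⟨rfl, rfl, h⟩
  · refine ⟨b, by omega, ?_⟩
    rw [simpleLabel, if_pos (by omega)]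
    simp [rootVec]
  · rcases lt_or_ge (c + 1) n with h' | h'
    · refine ⟨c, by omega, ?_⟩
      rw [simpleLabel, if_pos (by omega)]
      simp [rootVec]
    · refine ⟨2 * n - 2 - c, by omega, ?_⟩
      rw [simpleLabel, if_pos (by omega)]
      simp only [rootVec]
      rw [eps_eq_neg (show 2 * n - 2 - c + (c + 1) + 1 = 2 * n by omega),
        eps_eq_neg (show 2 * n - 2 - c + 1 + c + 1 = 2 * n by omega)]
      abel
  · refine ⟨n - 1, by omega, ?_⟩
    rw [simpleLabel, if_neg (by omega)]
    simp only [rootVec]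
    rcases h with rfl | rfl
    · simp
    · rw [eps_eq_neg (show c + 1 + c + 1 = 2 * (c + 1) by omega),
        eps_eq_neg (show c + 2 + (c + 1 - 2) + 1 = 2 * (c + 1) by omega)]
      abel

/-- The inner products of the simple roots are the entries of the Cartan matrix. -/
theorem stdForm_simple [CharZero R] {n : ℕ} (hn : 3 ≤ n) (j k : Fin n) :
    stdForm R n (rootVec R n (simpleLabel n j)) (rootVec R n (simpleLabel n k)) =
      (CartanMatrix.D n j k : R) := by
  rw [stdForm_rootVec (simpleLabel_mem hn) (simpleLabel_mem hn), Int.cast_inj]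
  obtain ⟨j, hj⟩ := j
  obtain ⟨k, hk⟩ := k
  simp only [CartanMatrix.D, Matrix.of_apply, Fin.mk.injEq]
  by_cases hj' : j + 1 < n <;> by_cases hk' : k + 1 < n
  all_goals simp only [simpleLabel, hj', hk', if_true, if_false]
  · omega
  · omega
  · omega
  · omega

/-- The permutation of the weights induced by the reflection in `eps u - eps w`. -/
def reflIndex (n u w a : ℕ) : ℕ :=
  if a = u then w else if a = w then u else if a + u + 1 = 2 * n then 2 * n - 1 - w
  else if a + w + 1 = 2 * n then 2 * n - 1 - u else a

/-- The reflection swaps `eps u` with `eps w`, hence also their negatives, and fixes the other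
weights. The hypothesis `huw'` excludes `eps w = -eps u`. -/
theorem eps_sub_stdForm_smul {n u w a : ℕ} (hu : u < 2 * n) (hw : w < 2 * n) (huw : u ≠ w)
    (huw' : u + w + 1 ≠ 2 * n) (ha : a < 2 * n) :
    eps R n a - stdForm R n (eps R n a) (eps R n u - eps R n w) • (eps R n u - eps R n w) =
      eps R n (reflIndex n u w a) := by
  rw [map_sub, stdForm_eps ha hu, stdForm_eps ha hw, reflIndex]
  by_cases h1 : a = u
  · subst h1
    rw [if_pos rfl, if_pos rfl, if_neg (by omega), if_neg huw, if_neg huw']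
    simp
  by_cases h2 : a = w
  · subst h2
    rw [if_neg h1, if_neg h1, if_pos rfl, if_pos rfl, if_neg (by omega), if_neg (by omega)]
    simp
  by_cases h3 : a + u + 1 = 2 * n
  · rw [if_neg h1, if_neg h1, if_neg h2, if_neg h2, if_pos h3, if_pos h3, if_neg (by omega),
      eps_eq_neg h3, eps_eq_neg (show 2 * n - 1 - w + w + 1 = 2 * n by omega)]
    module
  by_cases h4 : a + w + 1 = 2 * n
  · rw [if_neg h1, if_neg h1, if_neg h2, if_neg h2, if_neg h3, if_neg h3, if_pos h4, if_pos h4,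
      eps_eq_neg h4, eps_eq_neg (show 2 * n - 1 - u + u + 1 = 2 * n by omega)]
    module
  · rw [if_neg h1, if_neg h1, if_neg h2, if_neg h2, if_neg h3, if_neg h3, if_neg h4, if_neg h4]
    simp

end Standard

/-! ### Root systems of type `D` -/

section RootSystem

variable {ι R M N : Type*} [Field R] [AddCommGroup M] [Module R M] [AddCommGroup N] [Module R N]
  {P : RootPairing ι R M N} [P.IsRootSystem]
  {b : P.Base} {n : ℕ} (e : b.support ≃ Fin n)

/-- The linear map that sends the simple roots to their standard realizations. -/
def coord : M →ₗ[R] (ℕ → R) :=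
  b.toWeightBasis.constr R fun j => rootVec R n (simpleLabel n (e j))

theorem coord_simple (j : b.support) :
    coord e (P.root j) = rootVec R n (simpleLabel n (e j)) := by
  rw [coord, ← b.toWeightBasis_apply, Module.Basis.constr_basis]

variable {e} [CharZero R]

theorem height_eq_heightForm (hn : 3 ≤ n) (i : ι) :
    (b.height i : R) = heightForm R n (coord e (P.root i)) := by
  obtain ⟨f, -, -, hf⟩ := b.exists_root_eq_sum_int i
  have hs (j : ι) (hj : j ∈ b.support) : heightForm R n (coord e (P.root j)) = 1 := by
    rw [coord_simple e ⟨j, hj⟩, rootVec, map_sub]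
    have hs := simpleLabel_mem (n := n) (k := e ⟨j, hj⟩) hn
    rw [← Prod.mk.eta (p := simpleLabel n (e ⟨j, hj⟩)), mem_dRoots] at hs
    rw [heightForm_eps (by omega), heightForm_eps (by omega), ← Int.cast_sub,
      Int.cast_eq_one]
    unfold simpleLabel at *
    split_ifs at * <;> simp only at * <;> omega
  rw [RootPairing.Base.height_eq_sum hf, hf, map_sum, map_sum, Int.cast_sum]
  refine Finset.sum_congr rfl fun j hj => ?_
  rw [map_zsmul, map_zsmul, hs j hj, zsmul_one]

/-- Positivity is positivity of the height, and `heightForm` decreases along the list of weights.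
The only tie, between `eps (n - 1)` and `eps n`, is excluded by `hac`. -/
theorem isPos_iff_lt (hn : 3 ≤ n) {i : ι} {a c : ℕ} (ha : a < 2 * n) (hc : c < 2 * n)
    (hac : a + c + 1 ≠ 2 * n)
    (h : coord e (P.root i) = eps R n a - eps R n c) : b.IsPos i ↔ a < c := by
  have hh := height_eq_heightForm (e := e) hn i
  rw [h, map_sub, heightForm_eps ha, heightForm_eps hc, ← Int.cast_sub, Int.cast_inj] at hh
  rw [b.isPos_iff, hh]
  split_ifs <;> omega

variable [P.IsCrystallographic]

/-- Both sides are linear in `x` and agree on simple roots by equality of Cartan matrices. As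
standard simple roots have norm 2, the form itself plays the role of the coroot. -/
theorem stdForm_coord (hn : 3 ≤ n) (he : ∀ i j, b.cartanMatrix i j = CartanMatrix.D n (e i) (e j))
    (x : M) (k : b.support) :
    stdForm R n (coord e x) (rootVec R n (simpleLabel n (e k))) = P.coroot' k x := by
  have : ((stdForm R n).flip (rootVec R n (simpleLabel n (e k)))) ∘ₗ coord e = P.coroot' k := by
    refine b.toWeightBasis.ext fun j => ?_
    rw [b.toWeightBasis_apply, LinearMap.comp_apply, LinearMap.flip_apply, coord_simple,
      stdForm_simple hn, ← he, P.root_coroot'_eq_pairing]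
    exact b.algebraMap_cartanMatrixIn_apply ℤ j k
  exact LinearMap.congr_fun this x

/-- A vector killed by `coord` is killed by every simple coroot; these form a basis and the pairing
is perfect. -/
theorem coord_injective (hn : 3 ≤ n)
    (he : ∀ i j, b.cartanMatrix i j = CartanMatrix.D n (e i) (e j)) :
    Function.Injective (coord e) := by
  refine (injective_iff_map_eq_zero _).mpr fun x hx => ?_
  have h : P.toLinearMap x = 0 := by
    refine b.toCoweightBasis.ext fun k => ?_
    have := stdForm_coord hn he x k
    rw [hx, map_zero, LinearMap.zero_apply] at this
    rw [b.toCoweightBasis_apply, LinearMap.zero_apply]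
    exact this.symm
  exact (LinearMap.IsPerfPair.bijective_left P.toLinearMap).1 (h.trans (map_zero _).symm)

theorem coord_reflectionPerm (hn : 3 ≤ n)
    (he : ∀ i j, b.cartanMatrix i j = CartanMatrix.D n (e i) (e j)) {i : ι} (k : b.support)
    {a c : ℕ} (ha : a < 2 * n) (hc : c < 2 * n) (h : coord e (P.root i) = eps R n a - eps R n c) :
    coord e (P.root (P.reflectionPerm k i)) =
      eps R n (reflIndex n (simpleLabel n (e k)).1 (simpleLabel n (e k)).2 a) -
      eps R n (reflIndex n (simpleLabel n (e k)).1 (simpleLabel n (e k)).2 c) := by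
  have hs := simpleLabel_mem (n := n) (k := e k) hn
  set u := (simpleLabel n (e k)).1 with hu
  set w := (simpleLabel n (e k)).2 with hw
  rw [show simpleLabel n (e k) = (u, w) from rfl, mem_dRoots] at hs
  rw [← eps_sub_stdForm_smul (a := a) (by omega) (by omega) (by omega) (by omega) ha,
    ← eps_sub_stdForm_smul (a := c) (by omega) (by omega) (by omega) (by omega) hc,
    P.root_reflectionPerm, P.reflection_apply, map_sub, map_smul, ← stdForm_coord hn he,
    coord_simple, h]
  simp only [rootVec, ← hu, ← hw]
  rw [map_sub (stdForm R n), LinearMap.sub_apply]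
  module

theorem reflIndex_lt {n u w a : ℕ} (hu : u < 2 * n) (hw : w < 2 * n) (ha : a < 2 * n) :
    reflIndex n u w a < 2 * n := by
  unfold reflIndex
  split_ifs <;> omega

theorem reflIndex_ne {n u w a c : ℕ} (hu : u < 2 * n) (hw : w < 2 * n) (huw : u ≠ w)
    (ha : a < 2 * n) (hc : c < 2 * n) (hac : a ≠ c) :
    reflIndex n u w a ≠ reflIndex n u w c := by
  unfold reflIndex
  split_ifs <;> omega

theorem reflIndex_add_ne {n u w a c : ℕ} (hu : u < 2 * n) (hw : w < 2 * n)
    (huw : u + w + 1 ≠ 2 * n) (ha : a < 2 * n) (hc : c < 2 * n) (hac : a + c + 1 ≠ 2 * n) :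
    reflIndex n u w a + reflIndex n u w c + 1 ≠ 2 * n := by
  unfold reflIndex
  split_ifs <;> omega

/-- Every root is of the form `eps a - eps c`. -/
theorem exists_coord_root_eq [Finite ι] [P.IsReduced] (hn : 3 ≤ n)
    (he : ∀ i j, b.cartanMatrix i j = CartanMatrix.D n (e i) (e j)) (i : ι) :
    ∃ a c, a < 2 * n ∧ c < 2 * n ∧ a ≠ c ∧ a + c + 1 ≠ 2 * n ∧
      coord e (P.root i) = eps R n a - eps R n c := by
  -- Every root arises from simple ones by negation and simple reflections, and both preserve the
  -- shape `eps a - eps c` because the latter permute the weights.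
  refine RootPairing.Base.induction_reflect (b := b) (p := fun i => ∃ a c, a < 2 * n ∧ c < 2 * n ∧
    a ≠ c ∧ a + c + 1 ≠ 2 * n ∧ coord e (P.root i) = eps R n a - eps R n c) i ?_ ?_ ?_
  · rintro i ⟨a, c, ha, hc, hac, hac', h⟩
    refine ⟨c, a, hc, ha, hac.symm, by omega, ?_⟩
    rw [P.root_reflectionPerm, P.reflection_apply_self, map_neg, h, neg_sub]
  · intro j hj
    have hs := simpleLabel_mem (n := n) (k := e ⟨j, hj⟩) hn
    rw [← Prod.mk.eta (p := simpleLabel n (e ⟨j, hj⟩)), mem_dRoots] at hs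
    exact ⟨_, _, by omega, by omega, by omega, by omega, coord_simple e ⟨j, hj⟩⟩
  · rintro i k ⟨a, c, ha, hc, hac, hac', h⟩ hk
    have hs := simpleLabel_mem (n := n) (k := e ⟨k, hk⟩) hn
    rw [← Prod.mk.eta (p := simpleLabel n (e ⟨k, hk⟩)), mem_dRoots] at hs
    exact ⟨_, _, reflIndex_lt (by omega) (by omega) ha, reflIndex_lt (by omega) (by omega) hc,
      reflIndex_ne (by omega) (by omega) (by omega) ha hc hac,
      reflIndex_add_ne (by omega) (by omega) (by omega) ha hc hac',
      coord_reflectionPerm hn he ⟨k, hk⟩ ha hc h⟩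

/-- Every pair of the model is realized by a root. -/
theorem exists_root_coord_eq (hn : 3 ≤ n)
    (he : ∀ i j, b.cartanMatrix i j = CartanMatrix.D n (e i) (e j)) (a c : ℕ)
    (h : (a, c) ∈ dRoots n) : ∃ i, coord e (P.root i) = rootVec R n (a, c) := by
  have simple (k : ℕ) (hk : k < n) : ∃ i, coord e (P.root i) = rootVec R n (simpleLabel n k) :=
    ⟨e.symm ⟨k, hk⟩, by rw [coord_simple, Equiv.apply_symm_apply]⟩
  have refl (k c d : ℕ) (hk : k < n) (hd : (a, d) ∈ dRoots n)
      (hi : ∃ i, coord e (P.root i) = rootVec R n (a, d))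
      (h1 : reflIndex n (simpleLabel n k).1 (simpleLabel n k).2 a = a)
      (h2 : reflIndex n (simpleLabel n k).1 (simpleLabel n k).2 d = c) :
      ∃ i, coord e (P.root i) = rootVec R n (a, c) := by
    obtain ⟨i, hi⟩ := hi
    rw [mem_dRoots] at hd
    have := coord_reflectionPerm hn he (e.symm ⟨k, hk⟩) (by omega) (by omega) hi
    rw [Equiv.apply_symm_apply] at this
    exact ⟨_, this.trans (by rw [h1, h2]; rfl)⟩
  induction c using Nat.strong_induction_on with
  | _ c ih =>
  have h' := mem_dRoots.mp h
  -- With `a` fixed, column `c` is reached by one simple reflection that fixes `eps a`: from `c - 1`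
  -- if `c ≠ n`, and from `n - 2` by the last simple root if `c = n`. The starting points are the
  -- simple roots themselves.
  rcases lt_trichotomy c n with hc | hc | hc
  · rcases eq_or_ne c (a + 1) with rfl | hne
    · obtain ⟨i, hi⟩ := simple a (by omega)
      rw [simpleLabel, if_pos hc] at hi
      exact ⟨i, hi⟩
    · have hd : (a, c - 1) ∈ dRoots n := mem_dRoots.mpr (by omega)
      refine refl (c - 1) c (c - 1) (by omega) hd (ih _ (by omega) hd) ?_ ?_ <;>
        rw [simpleLabel, if_pos (by omega), reflIndex] <;> split_ifs <;> omega
  · rcases eq_or_ne c (a + 2) with hca | hne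
    · obtain ⟨i, hi⟩ := simple (n - 1) (by omega)
      rw [simpleLabel, if_neg (by omega), show (n - 2, n) = (a, c) by
        rw [Prod.mk.injEq]; omega] at hi
      exact ⟨i, hi⟩
    · have hd : (a, c - 2) ∈ dRoots n := mem_dRoots.mpr (by omega)
      refine refl (n - 1) c (c - 2) (by omega) hd (ih _ (by omega) hd) ?_ ?_ <;>
        rw [simpleLabel, if_neg (by omega), reflIndex] <;> split_ifs <;> omega
  · have hd : (a, c - 1) ∈ dRoots n := mem_dRoots.mpr (by omega)
    refine refl (2 * n - 1 - c) c (c - 1) (by omega) hd (ih _ (by omega) hd) ?_ ?_ <;>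
      rw [simpleLabel, if_pos (by omega), reflIndex] <;> split_ifs <;> omega

theorem exists_label [Finite ι] [P.IsReduced] (hn : 3 ≤ n)
    (he : ∀ i j, b.cartanMatrix i j = CartanMatrix.D n (e i) (e j)) (γ : PosRoot b) :
    ∃ p ∈ dRoots n, coord e γ.vec = rootVec R n p := by
  obtain ⟨a, c, ha, hc, hac, hac', h⟩ := exists_coord_root_eq hn he γ.1
  have hlt := (isPos_iff_lt hn ha hc hac' h).mp γ.2
  rcases lt_or_gt_of_ne hac' with h1 | h1
  · exact ⟨(a, c), mem_dRoots.mpr ⟨hlt, h1⟩, h⟩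
  · refine ⟨(2 * n - 1 - c, 2 * n - 1 - a), mem_dRoots.mpr (by omega), h.trans ?_⟩
    rw [rootVec, eps_eq_neg (show 2 * n - 1 - c + c + 1 = 2 * n by omega),
      eps_eq_neg (show 2 * n - 1 - a + a + 1 = 2 * n by omega)]
    abel

theorem exists_posRoot (hn : 3 ≤ n)
    (he : ∀ i j, b.cartanMatrix i j = CartanMatrix.D n (e i) (e j)) {p : ℕ × ℕ}
    (hp : p ∈ dRoots n) : ∃ γ : PosRoot b, coord e γ.vec = rootVec R n p := by
  obtain ⟨a, c⟩ := p
  obtain ⟨i, hi⟩ := exists_root_coord_eq hn he a c hp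
  rw [mem_dRoots] at hp
  exact ⟨⟨i, (isPos_iff_lt hn (by omega) (by omega) (by omega) hi).mpr hp.1⟩, hi⟩

/-- The labelling of the positive roots of a root system of type `D_n`. -/
def rootLabelling [Finite ι] [P.IsReduced] (hn : 3 ≤ n)
    (he : ∀ i j, b.cartanMatrix i j = CartanMatrix.D n (e i) (e j)) : RootLabelling b n where
  label γ := (exists_label hn he γ).choose
  injective γ γ' h := by
    have h1 := (exists_label hn he γ).choose_spec.2
    have h2 := (exists_label hn he γ').choose_spec.2
    exact vec_injective (coord_injective hn he (h1.trans ((congrArg _ h).trans h2.symm)))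
  mem_dRoots γ := (exists_label hn he γ).choose_spec.1
  surjective p hp := by
    obtain ⟨γ, hγ⟩ := exists_posRoot hn he hp
    have h1 := (exists_label hn he γ).choose_spec
    exact ⟨γ, rootVec_injOn (R := R) h1.1 hp (h1.2.symm.trans hγ)⟩
  step_iff μ γ := by
    obtain ⟨h1, h2⟩ := (exists_label hn he μ).choose_spec
    obtain ⟨h3, h4⟩ := (exists_label hn he γ).choose_spec
    constructor
    · rintro ⟨i, hi, h⟩
      refine DStep_of_rootVec_sub (R := R) (k := e ⟨i, hi⟩) hn h1 h3 ?_
      rw [← h2, ← h4, ← map_sub, h, coord_simple e ⟨i, hi⟩]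
    · intro h
      obtain ⟨k, hk, h⟩ := exists_rootVec_sub_eq (R := R) hn h1 h3 h
      refine ⟨e.symm ⟨k, hk⟩, (e.symm ⟨k, hk⟩).2, coord_injective hn he ?_⟩
      rw [map_sub, coord_simple, Equiv.apply_symm_apply, h2, h4, h]
  sum_iff γ γ' := by
    obtain ⟨h1, h2⟩ := (exists_label hn he γ).choose_spec
    obtain ⟨h3, h4⟩ := (exists_label hn he γ').choose_spec
    constructor
    · rintro ⟨δ, h⟩
      obtain ⟨h5, h6⟩ := (exists_label hn he δ).choose_spec
      refine DSum_of_rootVec_add (R := R) h1 h3 h5 ?_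
      rw [← h2, ← h4, ← h6, h, map_add]
    · intro h
      obtain ⟨r, hr, h⟩ := exists_rootVec_eq_add (R := R) h1 h3 h
      obtain ⟨δ, hδ⟩ := exists_posRoot hn he hr
      refine ⟨δ, coord_injective hn he ?_⟩
      rw [map_add, h2, h4, hδ, h]

end RootSystem

end TypeD

end

theorem theorem4p4 {ι R M N : Type*} [Finite ι] [Field R] [CharZero R]
    [AddCommGroup M] [Module R M] [AddCommGroup N] [Module R N]
    (P : RootPairing ι R M N) [P.IsRootSystem] [P.IsCrystallographic] [P.IsReduced]
    (b : P.Base) (n : ℕ) (hn : 3 ≤ n) (hD : IsTypeD b n) :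
    (∀ k : ℕ, (upperCoveringPoly (AbelianIdeals b)).coeff k =
      binom (n + 2) (2 * k) - 4 * binom (n - 1) (2 * k - 2)) ∧
    (∀ k : ℕ, (upperCoveringPoly (AbelianIdeals b)).coeff k =
      binom n (2 * k) + binom (n - 1) (2 * k - 1) + binom (n - 2) (2 * k - 1)
        + binom (n - 2) (2 * k - 4)) ∧
    (∀ k : ℕ, (lowerCoveringPoly (AbelianIdeals b)).coeff k =
      binom n (2 * k + 1) + binom n (2 * k - 2)) ∧
    (∀ k : ℕ, (deviationPoly (AbelianIdeals b)).coeff k =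
      -(binom (n - 2) (2 * k + 1) + binom (n - 3) (2 * k))) := by
  obtain ⟨e, he⟩ := hD
  have iso := (TypeD.rootLabelling hn he).orderIso
  exact TypeD.coeff_formulas_of_closed_forms hn
    ((upperCoveringPoly_congr iso).trans (TypeD.upperCoveringPoly_dIdeals hn))
    ((lowerCoveringPoly_congr iso).trans (TypeD.lowerCoveringPoly_dIdeals hn))
    (upperCoveringPoly_sub_lowerCoveringPoly _)
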